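/- Let $M$ be a complete Riemannian manifold and let $\mathcal F$ be a singular Riemannian foliation on $M$ with closed leaves: a partition of $M$ into connected immersed submanifolds (the leaves), such that every vector tangent to a leaf extends to a smooth vector field on $M$ that is everywhere tangent to the leaves, and such that every geodesic perpendicular to one leaf is perpendicular to every leaf it meets. Let $\Sigma$ be a minimal stratum, i.e. the union of all leaves of minimal dimension, or a connected component (or a nonempty union of connected components) of it. Let $r>0$ be so small that $B=\mathrm{Tub}_r(\Sigma)=\{x\in M: d(x,\Sigma)<r\}$ is a tubular neighborhood, i.e. the normal exponential map $\exp^\perp$ is a diffeomorphism from $\{\xi\in\nu\Sigma:\|\xi\|<r\}$ onto $B$, where $\nu\Sigma$ is the normal bundle of $\Sigma$. Let $$\widehat B=\{(x,[\xi])\in B\times\mathbb P(\nu\Sigma)\;:\; x=\exp^\perp(t\xi)\text{ for some } t\in\mathbb R \text{ with } \|t\xi\|<r\}$$ be the blow-up of $B$ along $\Sigma$, with its smooth structure as a submanifold of $B\times\mathbb P(\nu\Sigma)$, and let $\hat\rho:\widehat B\to B$, $\hat\rho(x,[\xi])=x$. A continuous function $h:B\to\mathbb R$ that is basic (constant on the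 leaves of $\mathcal F$) is called a blow-up function if (a) $h\circ\hat\rho$ is smooth on $\widehat B$; (b) the restrictions of $h$ to $\Sigma$ and to $B-\Sigma$ are smooth; (c) the derivative of $h$ in every direction normal to $\Sigma$ vanishes: $\frac{d}{dt}\big|_{t=0}h(\exp^\perp(t\xi))$ exists and equals $0$ for every $\xi\in\nu\Sigma$. Then every blow-up function $h$ is of class $C^1$ on $B$. -/

import Mathlib

open Set Filter Topology Bundle Manifold
open scoped ContDiff LinearAlgebra.Projectivization

universe u

noncomputable section

namespace BlowUpFoliation

/-- Euclidean model space of dimension `n`. -/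
abbrev Model (n : ℕ) : Type := EuclideanSpace ℝ (Fin n)

section Curves

variable {n : ℕ} {M : Type u} [TopologicalSpace M] [ChartedSpace (Model n) M]

/-- The velocity `(γ t, γ' t)` of a curve, as a point of the tangent bundle. -/
def velocity (n : ℕ) {M : Type u} [TopologicalSpace M] [ChartedSpace (Model n) M]
    (γ : ℝ → M) (t : ℝ) : TangentBundle (𝓡 n) M :=
  ⟨γ t, mfderiv 𝓘(ℝ, ℝ) (𝓡 n) γ t (1 : ℝ)⟩

/-- Multiplication by `t` in the fibre of the tangent bundle through `v`. -/
def scale (t : ℝ) (v : TangentBundle (𝓡 n) M) : TangentBundle (𝓡 n) M :=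
  ⟨v.proj, t • v.2⟩

/-- `L` is a connected immersed submanifold of `M`, with tangent space `T x` at each `x ∈ L`:
the image of a connected manifold under an injective immersion `ι` such that `T (ι y)` is the image
of `dι` at `y`. -/
def IsConnectedImmersedSubmanifold (L : Set M)
    (T : ∀ x : M, Submodule ℝ (TangentSpace (𝓡 n) x)) : Prop :=
  ∃ (k : ℕ) (N : Type u) (_ : TopologicalSpace N) (_ : ChartedSpace (Model k) N) (ι : N → M),
    IsManifold (𝓡 k) ∞ N ∧ T2Space N ∧ SecondCountableTopology N ∧ ConnectedSpace N ∧
    Function.Injective ι ∧ range ι = L ∧ IsImmersion (𝓡 k) (𝓡 n) ∞ ι ∧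
    ∀ y : N, (mfderiv (𝓡 k) (𝓡 n) ι y).range = T (ι y)

/-- The tangent space `T_q S` of a subset `S` of `M`: the span of the velocities at `q` of the
smooth curves through `q` that stay in `S`. For an embedded submanifold `S` this is its tangent
space. -/
def tangentSpaceOf (S : Set M) (q : M) : Submodule ℝ (TangentSpace (𝓡 n) q) :=
  Submodule.span ℝ {v | ∃ c : ℝ → M, ContMDiffAt 𝓘(ℝ, ℝ) (𝓡 n) ∞ c 0 ∧
    (∀ᶠ t in 𝓝 (0 : ℝ), c t ∈ S) ∧ velocity n c 0 = ⟨q, v⟩}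

end Curves

section Riemannian

variable {n : ℕ} {M : Type u} [MetricSpace M] [ChartedSpace (Model n) M]
  [IsManifold (𝓡 n) ∞ M] [RiemannianBundle (fun x : M => TangentSpace (𝓡 n) x)]

/-- The Riemannian metric in the preferred chart at `x₀`: the value `g_y(u, w)` at the point with
coordinates `y`, for coordinate vectors `u`, `w`. -/
def chartMetric (x₀ : M) (y u w : Model n) : ℝ :=
  inner ℝ (mfderiv 𝓘(ℝ, Model n) (𝓡 n) (extChartAt (𝓡 n) x₀).symm y u)
    (mfderiv 𝓘(ℝ, Model n) (𝓡 n) (extChartAt (𝓡 n) x₀).symm y w)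

/-- Geodesics `ℝ → M`: smooth curves satisfying in charts the geodesic equation, written as the
Euler-Lagrange equation of the energy. With `c` the coordinate expression of the curve it reads
`d/ds g_{c(s)}(c'(s), w) = (1/2) (D_w g)_{c(s)}(c'(s), c'(s))` for all constant `w`. -/
def IsGeodesic (γ : ℝ → M) : Prop :=
  ContMDiff 𝓘(ℝ, ℝ) (𝓡 n) ∞ γ ∧
  ∀ (x₀ : M) (t : ℝ), γ t ∈ (chartAt (Model n) x₀).source → ∀ w : Model n,
    HasDerivAt
      (fun s => chartMetric x₀ (extChartAt (𝓡 n) x₀ (γ s))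
        (deriv (fun a => extChartAt (𝓡 n) x₀ (γ a)) s) w)
      ((1 / 2) * deriv (fun ε : ℝ => chartMetric x₀ (extChartAt (𝓡 n) x₀ (γ t) + ε • w)
        (deriv (fun a => extChartAt (𝓡 n) x₀ (γ a)) t)
        (deriv (fun a => extChartAt (𝓡 n) x₀ (γ a)) t)) 0) t

open Classical in
/-- The Riemannian exponential map of a complete manifold: `exp v = γ 1` for the geodesic `γ` with
initial velocity `v` (the value where there is no such geodesic is irrelevant). -/
def expMap (v : TangentBundle (𝓡 n) M) : M :=
  if hv : ∃ γ : ℝ → M, IsGeodesic (n := n) γ ∧ velocity n γ 0 = v then hv.choose 1 else v.proj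

/-- The normal space `ν_q S`. -/
def normalSpace (S : Set M) (q : M) : Submodule ℝ (TangentSpace (𝓡 n) q) :=
  (tangentSpaceOf S q)ᗮ

/-- The normal bundle `νS`, as a subset of the tangent bundle. -/
def normalBundle (S : Set M) : Set (TangentBundle (𝓡 n) M) :=
  {v | v.proj ∈ S ∧ v.2 ∈ normalSpace S v.proj}

/-- The normal vectors of length less than `r`. -/
def normalDisc (S : Set M) (r : ℝ) : Set (TangentBundle (𝓡 n) M) :=
  {v | v ∈ normalBundle S ∧ ‖v.2‖ < r}

/-- `Tub_r(S)` (here `Metric.thickening r S`, the set of points at distance less than `r` from `S`)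
is a tubular neighbourhood: the normal exponential map is a diffeomorphism from the bundle of normal
discs of radius `r` onto it. -/
def IsTubularRadius (n : ℕ) {M : Type u} [MetricSpace M] [ChartedSpace (Model n) M]
    [IsManifold (𝓡 n) ∞ M] [RiemannianBundle (fun x : M => TangentSpace (𝓡 n) x)]
    (S : Set M) (r : ℝ) : Prop :=
  0 < r ∧
  ContMDiffOn (𝓡 n).tangent (𝓡 n) ∞ (expMap (n := n) (M := M)) (normalDisc S r) ∧
  ∃ J : M → TangentBundle (𝓡 n) M,
    ContMDiffOn (𝓡 n) (𝓡 n).tangent ∞ J (Metric.thickening r S) ∧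
    MapsTo expMap (normalDisc (n := n) S r) (Metric.thickening r S) ∧
    MapsTo J (Metric.thickening r S) (normalDisc S r) ∧
    InvOn J expMap (normalDisc S r) (Metric.thickening r S)

/-- Singular Riemannian foliations: partitions (the leaves are the classes of `rel`) into connected
immersed submanifolds such that every vector tangent to a leaf extends to a smooth vector field
tangent to the leaves, and every geodesic perpendicular to one leaf is perpendicular to every leaf
it meets. -/
structure SingularRiemannianFoliation (n : ℕ) (M : Type u) [MetricSpace M]
    [ChartedSpace (Model n) M] [IsManifold (𝓡 n) ∞ M]
    [RiemannianBundle (fun x : M => TangentSpace (𝓡 n) x)] where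
  /-- two points lie on the same leaf -/
  rel : Setoid M
  /-- the tangent space at `p` of the leaf through `p` -/
  tangent : ∀ p : M, Submodule ℝ (TangentSpace (𝓡 n) p)
  leaf_immersed : ∀ p : M, IsConnectedImmersedSubmanifold {x | rel x p} tangent
  exists_vectorField : ∀ (p : M), ∀ v ∈ tangent p, ∃ Y : ∀ x : M, TangentSpace (𝓡 n) x,
    ContMDiff (𝓡 n) (𝓡 n).tangent ∞ (fun x => (⟨x, Y x⟩ : TangentBundle (𝓡 n) M)) ∧
    (∀ x, Y x ∈ tangent x) ∧ Y p = v
  transnormal : ∀ γ : ℝ → M, IsGeodesic (n := n) γ → ∀ s t : ℝ,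
    (velocity n γ s).2 ∈ (tangent (γ s))ᗮ → (velocity n γ t).2 ∈ (tangent (γ t))ᗮ

namespace SingularRiemannianFoliation

variable (F : SingularRiemannianFoliation n M)

/-- The leaf through `p`. -/
def leaf (p : M) : Set M := {x | F.rel x p}

/-- The union of the leaves of minimal dimension. -/
def minimalLocus : Set M :=
  {p | ∀ x, Module.finrank ℝ (F.tangent p) ≤ Module.finrank ℝ (F.tangent x)}

/-- `S` is a minimal stratum: a nonempty union of connected components of the union of the leaves
of minimal dimension. This covers both usages, stratum as the union of all leaves of one dimension
and stratum as a connected component of that union. -/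
def IsMinimalStratum (S : Set M) : Prop :=
  S.Nonempty ∧ S ⊆ F.minimalLocus ∧ ∀ x ∈ S, connectedComponentIn F.minimalLocus x ⊆ S

end SingularRiemannianFoliation

/-- The projectivised normal bundle `ℙ(νS)`: points `(q, ℓ)` with `q ∈ S` and `ℓ` a line in
`ν_q S`. -/
def ProjNormalBundle (n : ℕ) {M : Type u} [MetricSpace M] [ChartedSpace (Model n) M]
    [IsManifold (𝓡 n) ∞ M] [RiemannianBundle (fun x : M => TangentSpace (𝓡 n) x)]
    (S : Set M) : Type u :=
  Σ q : S, ℙ ℝ (normalSpace (n := n) S (q : M))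

/-- The blow-up of `Tub_r(S)` along `S`: the pairs `(x, [ξ])` in `Tub_r(S) × ℙ(νS)` such that
`x` is the exponential of a vector of length less than `r` on the line `[ξ]`. -/
def blowUp (n : ℕ) {M : Type u} [MetricSpace M] [ChartedSpace (Model n) M]
    [IsManifold (𝓡 n) ∞ M] [RiemannianBundle (fun x : M => TangentSpace (𝓡 n) x)]
    (S : Set M) (r : ℝ) : Set (M × ProjNormalBundle n S) :=
  {z | z.1 ∈ Metric.thickening r S ∧
    ∃ η ∈ z.2.2.submodule, ‖η‖ < r ∧ z.1 = expMap ⟨(z.2.1 : M), (η : TangentSpace (𝓡 n) _)⟩}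

/-- The blow-up map `(x, [ξ]) ↦ x`. -/
def blowUpMap {S : Set M} {r : ℝ} (z : blowUp n S r) : M := z.1.1

/-- The normal bundle without its zero section, `νS - 0`. -/
def puncturedNormalBundle (S : Set M) : Set (TangentBundle (𝓡 n) M) :=
  {v | v ∈ normalBundle S ∧ v.2 ≠ 0}

/-- The projection `νS - 0 → ℙ(νS)`, `ξ ↦ [ξ]`. -/
def projClass {S : Set M} (v : puncturedNormalBundle (n := n) S) : ProjNormalBundle n S :=
  ⟨⟨v.1.proj, v.2.1.1⟩, Projectivization.mk ℝ ⟨v.1.2, v.2.1.2⟩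
    (fun h => v.2.2 (congrArg Subtype.val h))⟩

/-- The inverse image of the blow-up under `M × (νS - 0) → M × ℙ(νS)`. -/
def blowUpCone (S : Set M) (r : ℝ) : Set (M × TangentBundle (𝓡 n) M) :=
  {z | ∃ hz : z.2 ∈ puncturedNormalBundle S, (z.1, projClass ⟨z.2, hz⟩) ∈ blowUp n S r}

/-- Smooth functions on the blow-up, for its smooth structure as a submanifold of `M × ℙ(νS)`,
where `ℙ(νS)` is the quotient of the submanifold `νS - 0` of `TM` by the (free and proper) action
of the nonzero scalars: `f` is smooth iff `(x, ξ) ↦ f (x, [ξ])` is smooth on the inverse image of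
the blow-up in `M × (νS - 0)`, because `M × (νS - 0) → M × ℙ(νS)` is a surjective submersion. On
a submanifold of an ambient manifold, smoothness in the sense of the submanifold is `ContMDiffOn`
for the ambient manifold. -/
def IsSmoothOnBlowUp {S : Set M} {r : ℝ} (f : blowUp n S r → ℝ) : Prop :=
  ∃ f' : M × TangentBundle (𝓡 n) M → ℝ,
    ContMDiffOn ((𝓡 n).prod (𝓡 n).tangent) 𝓘(ℝ, ℝ) ∞ f' (blowUpCone S r) ∧
    ∀ (z : M × TangentBundle (𝓡 n) M) (hz : z.2 ∈ puncturedNormalBundle S)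
      (hB : (z.1, projClass ⟨z.2, hz⟩) ∈ blowUp n S r),
      f' z = f ⟨(z.1, projClass ⟨z.2, hz⟩), hB⟩

/-- Blow-up functions on `B = Tub_r(S)`. Only the values of `h` on `B` matter. Basic means constant
on leaves; the blow-up map sends leaves to leaves, so `h ∘ blowUpMap` is then basic too. Since `h`
need not be differentiable on `S` a priori, its derivative in the direction of a normal vector `v`
is the derivative at `0` of `t ↦ h (exp (t v))`. -/
structure IsBlowUpFunction (F : SingularRiemannianFoliation n M) (S : Set M) (r : ℝ)
    (h : M → ℝ) : Prop where
  continuousOn : ContinuousOn h (Metric.thickening r S)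
  basic : ∀ x ∈ Metric.thickening r S, ∀ y ∈ Metric.thickening r S,
    x ∈ F.leaf y → h x = h y
  smooth_pullback : IsSmoothOnBlowUp (fun z : blowUp n S r => h (blowUpMap z))
  smooth_on_stratum : ContMDiffOn (𝓡 n) 𝓘(ℝ, ℝ) ∞ h S
  smooth_off_stratum : ContMDiffOn (𝓡 n) 𝓘(ℝ, ℝ) ∞ h (Metric.thickening r S \ S)
  normal_deriv : ∀ v ∈ normalBundle (n := n) S,
    HasDerivAt (fun t : ℝ => h (expMap (scale t v))) 0 0

end Riemannian

end BlowUpFoliation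

end

/-! Let `J` invert the normal exponential map and let π x = `(J x).proj` be the foot of x on S. Off
S the function h is smooth. Since π maps B smoothly into S and h is smooth on S, h ∘ π is smooth on
B, so it suffices to treat g = h - h ∘ π at points of S, where g vanishes. By
`contDiffAt_one_of_flat`, g is C¹ there once, on approaching S from outside, g = o(distance to S)
and dg → 0.

Both bounds come from dilating the normal directions. Put G(y, t) = h(exp(t J y)) - h(π y). Near a
point y₀ off S and t = 0 this is smooth (`contMDiffAt_dilation`), because (y, t) ↦ (exp(t J y), [J
y]) is a smooth map into the blow-up. Moreover G = 0 and ∂G/∂t = 0 at t = 0, by the hypothesis on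
normal derivatives. Hence G = o(t), and by symmetry of the second derivative also ∂G/∂y = o(t).

A point x near S is written as exp(t J y) with y = exp(t⁻¹ J x) and t = t(x) comparable to the
normal size of J x. With t frozen, g(x') = G(exp(t⁻¹ J x'), t) for x' near x, and the dilation x' ↦
exp(t⁻¹ J x') has Lipschitz constant O(1/t). So g(x) = o(t) and dg(x) = o(t) · O(1/t) = o(1)
(`eventually_small_of_flat`). The dilated points accumulate only at points y₀ of B off S, by
compactness of the sphere of directions (`IsTubularInverse.eventually_small`).

S enters only as a set with a tubular inverse, never through charts of its own: its smooth structure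
is replaced by the retraction π and by the left invertibility of dJ. -/

noncomputable section

namespace BlowUpFoliation

/-! ### Functions flat to first order along t = 0, and their dilations. -/

section Euclidean

variable {V W Y : Type*} [NormedAddCommGroup V] [NormedSpace ℝ V]
  [NormedAddCommGroup W] [NormedSpace ℝ W] [NormedAddCommGroup Y] [NormedSpace ℝ Y]

/-- If `G (·, 0)` and `∂G/∂t (·, 0)` vanish near `y₀`, then the derivative of `G` vanishes at the
points `(y, 0)`. -/
theorem eventually_fderiv_eq_zero_of_flat {G : Y × ℝ → ℝ} {y₀ : Y}
    (hG : ContDiffAt ℝ 2 G (y₀, 0)) (h0 : ∀ᶠ y in 𝓝 y₀, G (y, 0) = 0)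
    (h1 : ∀ᶠ y in 𝓝 y₀, HasDerivAt (fun t : ℝ => G (y, t)) 0 0) :
    ∀ᶠ y in 𝓝 y₀, fderiv ℝ G (y, 0) = 0 := by
  have hd : ∀ᶠ z in 𝓝 (y₀, (0 : ℝ)), DifferentiableAt ℝ G z := by
    filter_upwards [hG.eventually (by simp)] with z hz using hz.differentiableAt (by simp)
  have hd' : ∀ᶠ y in 𝓝 y₀, DifferentiableAt ℝ G (y, 0) :=
    (Continuous.prodMk_left (0 : ℝ)).continuousAt.eventually hd
  filter_upwards [hd', h0.eventually_nhds, h1] with y hy hy0 hy1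
  have e1 : HasFDerivAt (fun y' : Y => G (y', 0))
      ((fderiv ℝ G (y, 0)).comp (ContinuousLinearMap.inl ℝ Y ℝ)) y :=
    hy.hasFDerivAt.comp y (hasFDerivAt_prodMk_left y (0 : ℝ))
  have e1' : HasFDerivAt (fun y' : Y => G (y', 0)) (0 : Y →L[ℝ] ℝ) y :=
    (hasFDerivAt_const (0 : ℝ) y).congr_of_eventuallyEq hy0
  have e2 : HasFDerivAt (fun t : ℝ => G (y, t))
      ((fderiv ℝ G (y, 0)).comp (ContinuousLinearMap.inr ℝ Y ℝ)) 0 :=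
    hy.hasFDerivAt.comp (0 : ℝ) (hasFDerivAt_prodMk_right y (0 : ℝ))
  have f1 := e1.unique e1'
  have f2 := e2.unique hy1.hasFDerivAt
  ext w
  · simpa using DFunLike.congr_fun f1 w
  · simpa using DFunLike.congr_fun f2 1

/-- The strict derivative at `(y₀, 0)` is zero, so comparing `z` with its foot `(z.1, 0)`, where `G`
vanishes, gives a bound uniform in the base point. -/
theorem eventually_abs_le_of_flat {G : Y × ℝ → ℝ} {y₀ : Y}
    (hG : ContDiffAt ℝ 2 G (y₀, 0)) (h0 : ∀ᶠ y in 𝓝 y₀, G (y, 0) = 0)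
    (h1 : ∀ᶠ y in 𝓝 y₀, HasDerivAt (fun t : ℝ => G (y, t)) 0 0) {ε : ℝ} (hε : 0 < ε) :
    ∀ᶠ z in 𝓝 (y₀, (0 : ℝ)), |G z| ≤ ε * |z.2| := by
  have hs : HasStrictFDerivAt G (0 : Y × ℝ →L[ℝ] ℝ) (y₀, 0) := by
    have := hG.hasStrictFDerivAt (by simp)
    rwa [(eventually_fderiv_eq_zero_of_flat hG h0 h1).self_of_nhds] at this
  have hb := hs.isLittleO.bound hε
  have ht : Tendsto (fun z : Y × ℝ => (z, (z.1, (0 : ℝ)))) (𝓝 (y₀, 0))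
      (𝓝 ((y₀, (0 : ℝ)), (y₀, (0 : ℝ)))) := by
    apply Continuous.tendsto' (by fun_prop)
    simp
  have h0' : ∀ᶠ z : Y × ℝ in 𝓝 (y₀, 0), G (z.1, 0) = 0 :=
    (continuous_fst.tendsto (y₀, (0 : ℝ))).eventually h0
  filter_upwards [ht.eventually hb, h0'] with z hz hz0
  have : z - (z.1, (0 : ℝ)) = (0, z.2) := by ext <;> simp
  simpa [hz0, this] using hz

/-- The derivative of `G` in the horizontal directions is `o(t)`. -/
theorem eventually_horizontal_lipschitz_of_flat {G : Y × ℝ → ℝ} {y₀ : Y}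
    (hG : ContDiffAt ℝ 2 G (y₀, 0)) (h0 : ∀ᶠ y in 𝓝 y₀, G (y, 0) = 0)
    (h1 : ∀ᶠ y in 𝓝 y₀, HasDerivAt (fun t : ℝ => G (y, t)) 0 0) {ε : ℝ} (hε : 0 < ε) :
    ∀ᶠ z in 𝓝 ((y₀, y₀), (0 : ℝ)),
      |G (z.1.1, z.2) - G (z.1.2, z.2)| ≤ ε * |z.2| * ‖z.1.1 - z.1.2‖ := by
  have hflat := eventually_fderiv_eq_zero_of_flat hG h0 h1
  have hA : HasStrictFDerivAt (fderiv ℝ G) (fderiv ℝ (fderiv ℝ G) (y₀, 0)) (y₀, 0) :=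
    (hG.fderiv_right (m := 1) (by norm_num)).hasStrictFDerivAt (by simp)
  set A' := fderiv ℝ (fderiv ℝ G) (y₀, 0) with hA'
  have hsymm : IsSymmSndFDerivAt ℝ G (y₀, 0) := hG.isSymmSndFDerivAt (by simp)
  -- `fderiv ℝ G` vanishes along t = 0, so differentiating it in a horizontal direction gives zero.
  have hA'0 : ∀ w : Y, A' (w, 0) = 0 := by
    have e1 : HasFDerivAt (fun y' : Y => fderiv ℝ G (y', 0))
        (A'.comp (ContinuousLinearMap.inl ℝ Y ℝ)) y₀ :=
      hA.hasFDerivAt.comp y₀ (hasFDerivAt_prodMk_left y₀ (0 : ℝ))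
    have e1' : HasFDerivAt (fun y' : Y => fderiv ℝ G (y', 0))
        (0 : Y →L[ℝ] (Y × ℝ →L[ℝ] ℝ)) y₀ :=
      (hasFDerivAt_const (0 : Y × ℝ →L[ℝ] ℝ) y₀).congr_of_eventuallyEq hflat
    intro w
    simpa using DFunLike.congr_fun (e1.unique e1') w
  have hbound : ∀ᶠ z in 𝓝 (y₀, (0 : ℝ)), DifferentiableAt ℝ G z ∧
      ‖(fderiv ℝ G z).comp (ContinuousLinearMap.inl ℝ Y ℝ)‖ ≤ ε * |z.2| := by
    have hb := hA.isLittleO.bound hε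
    have ht : Tendsto (fun z : Y × ℝ => (z, (z.1, (0 : ℝ)))) (𝓝 (y₀, 0))
        (𝓝 ((y₀, (0 : ℝ)), (y₀, (0 : ℝ)))) := by
      apply Continuous.tendsto' (by fun_prop)
      simp
    have h0' : ∀ᶠ z : Y × ℝ in 𝓝 (y₀, 0), fderiv ℝ G (z.1, 0) = 0 :=
      (continuous_fst.tendsto (y₀, (0 : ℝ))).eventually hflat
    filter_upwards [ht.eventually hb, h0', hG.eventually (by simp)] with z hz hz0 hd
    refine ⟨hd.differentiableAt (by simp), ?_⟩
    have : z - (z.1, (0 : ℝ)) = (0, z.2) := by ext <;> simp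
    simp only [hz0, this, sub_zero] at hz
    have hn : ‖((0 : Y), z.2)‖ = |z.2| := by simp [Prod.norm_def]
    rw [hn] at hz
    refine ContinuousLinearMap.opNorm_le_bound _ (by positivity) fun w => ?_
    -- By symmetry the mixed second derivative vanishes as well. This improves the horizontal part
    -- of the derivative of `G` from O(t) to o(t).
    have e2 : A' (0, z.2) (w, 0) = 0 := by
      rw [hsymm.eq]
      simp [← hA', hA'0 w]
    have := (fderiv ℝ G z - A' (0, z.2)).le_of_opNorm_le hz (w, 0)
    simpa [e2, Prod.norm_def] using this
  obtain ⟨δ, hδ, hball⟩ := Metric.eventually_nhds_iff_ball.1 hbound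
  have hmem : ∀ᶠ z in 𝓝 ((y₀, y₀), (0 : ℝ)),
      (z.1.1, z.2) ∈ Metric.ball (y₀, (0 : ℝ)) δ ∧ (z.1.2, z.2) ∈ Metric.ball (y₀, (0 : ℝ)) δ := by
    refine Filter.Eventually.and ?_ ?_
    · exact (Continuous.tendsto' (f := fun z : (Y × Y) × ℝ => (z.1.1, z.2)) (by fun_prop) _ _
        rfl).eventually (Metric.ball_mem_nhds _ hδ)
    · exact (Continuous.tendsto' (f := fun z : (Y × Y) × ℝ => (z.1.2, z.2)) (by fun_prop) _ _
        rfl).eventually (Metric.ball_mem_nhds _ hδ)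
  filter_upwards [hmem] with z hz
  obtain ⟨⟨y, y'⟩, t⟩ := z
  rw [← ball_prod_same, mem_prod, mem_prod] at hz
  have := (convex_ball y₀ δ).norm_image_sub_le_of_norm_hasFDerivWithin_le
    (f := fun y => G (y, t))
    (f' := fun y => (fderiv ℝ G (y, t)).comp (ContinuousLinearMap.inl ℝ Y ℝ)) (C := ε * |t|)
    (fun x hx => by
      have hx' := hball (x, t) (by rw [← ball_prod_same]; exact ⟨hx, hz.1.2⟩)
      exact (hx'.1.hasFDerivAt.comp x (hasFDerivAt_prodMk_left x t)).hasFDerivWithinAt)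
    (fun x hx => (hball (x, t) (by rw [← ball_prod_same]; exact ⟨hx, hz.1.2⟩)).2)
    hz.2.1 hz.1.1
  simpa using this

/-- `R` recovers an increment from its image under `L'`; the constant 1 / (2(‖R‖ + 1)) in the strict
derivative makes the error at most half of the increment, so it can be absorbed. This gives a
Lipschitz inverse on the image of `L` without any structure on that image. -/
theorem eventually_norm_sub_le_of_leftInverse {L : Y → W} {L' : Y →L[ℝ] W} {y₀ : Y}
    (hL : HasStrictFDerivAt L L' y₀) {R : W →L[ℝ] Y} (hR : R.comp L' = ContinuousLinearMap.id ℝ Y) :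
    ∃ C > 0, ∀ᶠ z in 𝓝 (y₀, y₀), ‖z.1 - z.2‖ ≤ C * ‖L z.1 - L z.2‖ := by
  refine ⟨2 * (‖R‖ + 1), by positivity, ?_⟩
  filter_upwards [hL.isLittleO.bound (c := 1 / (2 * (‖R‖ + 1))) (by positivity)] with z hz
  have e : z.1 - z.2 = R (L z.1 - L z.2) - R (L z.1 - L z.2 - L' (z.1 - z.2)) := by
    have := DFunLike.congr_fun hR (z.1 - z.2)
    simp only [ContinuousLinearMap.comp_apply, ContinuousLinearMap.id_apply] at this
    rw [← map_sub, sub_sub_cancel, this]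
  have h1 : ‖z.1 - z.2‖ ≤ ‖R‖ * ‖L z.1 - L z.2‖ +
      ‖R‖ * (1 / (2 * (‖R‖ + 1)) * ‖z.1 - z.2‖) := by
    nth_rewrite 1 [e]
    refine (norm_sub_le _ _).trans (add_le_add (R.le_opNorm _) ((R.le_opNorm _).trans ?_))
    gcongr
  have h2 : ‖R‖ * (1 / (2 * (‖R‖ + 1)) * ‖z.1 - z.2‖) ≤ 1 / 2 * ‖z.1 - z.2‖ := by
    rw [← mul_assoc]
    gcongr
    rw [mul_one_div, div_le_div_iff₀ (by positivity) (by positivity)]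
    linarith
  nlinarith [norm_nonneg (L z.1 - L z.2), norm_nonneg R]

/-- The main estimate. The function `g` is written as `g x' = G (η x' t, t)` near a point `x` with
parameter `t = t x`, where `G` is flat to first order along `t = 0` and where, in suitable
coordinates, `η x' t` is obtained from `x'` by dilating the normal coordinates by `1 / t`. -/
theorem eventually_small_of_flat {E₁ E₂ : Type*} [NormedAddCommGroup E₁] [NormedSpace ℝ E₁]
    [NormedAddCommGroup E₂] [NormedSpace ℝ E₂] {𝒰 : Filter V} {g τ : V → ℝ} {η : V → ℝ → Y}
    {G : Y × ℝ → ℝ} {y₀ : Y} {p : V} {P : V → E₁ × E₂} {L : Y → E₁ × E₂}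
    {L' : Y →L[ℝ] E₁ × E₂} {R : E₁ × E₂ →L[ℝ] Y}
    (hG : ContDiffAt ℝ 2 G (y₀, 0)) (h0 : ∀ᶠ y in 𝓝 y₀, G (y, 0) = 0)
    (h1 : ∀ᶠ y in 𝓝 y₀, HasDerivAt (fun t : ℝ => G (y, t)) 0 0)
    (hL : HasStrictFDerivAt L L' y₀) (hR : R.comp L' = ContinuousLinearMap.id ℝ Y)
    (hP : ContDiffAt ℝ 1 P p) (h𝒰 : 𝒰 ≤ 𝓝 p) (hτ : Tendsto τ 𝒰 (𝓝 0)) (hτ0 : ∀ᶠ x in 𝒰, 0 < τ x)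
    (hη : Tendsto (fun x => η x (τ x)) 𝒰 (𝓝 y₀))
    (hloc : ∀ᶠ x in 𝒰, ContinuousAt (fun x' => η x' (τ x)) x ∧ ∀ᶠ x' in 𝓝 x,
      g x' = G (η x' (τ x), τ x) ∧ L (η x' (τ x)) = ((P x').1, (τ x)⁻¹ • (P x').2))
    {ε : ℝ} (hε : 0 < ε) :
    ∀ᶠ x in 𝒰, |g x| ≤ ε * τ x ∧ ‖fderiv ℝ g x‖ ≤ ε := by
  obtain ⟨C, hC, hanti⟩ := eventually_norm_sub_le_of_leftInverse hL hR
  obtain ⟨M, s, hs, hM⟩ := hP.exists_lipschitzOnWith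
  have hM' : ∀ᶠ x in 𝒰, ∀ᶠ x' in 𝓝 x, ‖P x' - P x‖ ≤ M * ‖x' - x‖ := by
    filter_upwards [h𝒰 (eventually_eventually_nhds.2 hs)] with x hx
    filter_upwards [hx] with x' hx'
    exact hM.norm_sub_le hx' hx.self_of_nhds
  -- `C` compares increments of `η` with those of `L ∘ η`, and `M` is a Lipschitz constant of `P`;
  -- the summand 1 keeps the denominator positive.
  set ε' : ℝ := ε / (C * (M + 1)) with hε'
  have hε'0 : 0 < ε' := by positivity
  have hlip := (eventually_horizontal_lipschitz_of_flat hG h0 h1 hε'0).and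
    ((continuous_fst.tendsto ((y₀, y₀), (0 : ℝ))).eventually hanti)
  -- The estimate is needed on a whole neighbourhood of `((η x (τ x), η x (τ x)), τ x)`, since `x'`
  -- will vary around `x` while `τ x` stays fixed.
  have hlip' := ((hη.prodMk_nhds hη).prodMk_nhds hτ).eventually hlip.eventually_nhds
  have habs := (hη.prodMk_nhds hτ).eventually (eventually_abs_le_of_flat hG h0 h1 hε)
  have hτ1 : ∀ᶠ x in 𝒰, τ x < 1 := hτ.eventually_lt_const one_pos
  filter_upwards [hlip', habs, hM', hτ0, hτ1, hloc] with x hx1 hx2 hx3 hx4 hx5 hx6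
  obtain ⟨hcont, hev⟩ := hx6
  constructor
  · rw [hev.self_of_nhds.1]
    simpa [abs_of_pos hx4] using hx2
  -- The derivative is bounded by a Lipschitz estimate at `x` with the parameter frozen at `τ x`;
  -- neither `τ` nor `η` has to be differentiated.
  refine norm_fderiv_le_of_lip' ℝ hε.le ?_
  have hct : ContinuousAt (fun x' => ((η x' (τ x), η x (τ x)), τ x)) x :=
    (hcont.prodMk continuousAt_const).prodMk continuousAt_const
  filter_upwards [hct.eventually hx1, hx3, hev] with x' k1 k2 k3
  obtain ⟨k1, k4⟩ := k1
  simp only [abs_of_pos hx4] at k1 k4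
  rw [k3.1, hev.self_of_nhds.1, Real.norm_eq_abs]
  refine k1.trans ?_
  rw [k3.2, hev.self_of_nhds.2] at k4
  have k5 : ‖(((P x').1, (τ x)⁻¹ • (P x').2) : E₁ × E₂) - ((P x).1, (τ x)⁻¹ • (P x).2)‖
      ≤ (τ x)⁻¹ * ‖P x' - P x‖ := by
    rw [Prod.mk_sub_mk, ← smul_sub, Prod.norm_def]
    -- The undilated base component is also bounded by the dilation factor, as `τ x < 1`.
    have hone : 1 ≤ (τ x)⁻¹ := (one_le_inv₀ hx4).2 hx5.le
    refine max_le ?_ ?_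
    · calc ‖(P x').1 - (P x).1‖ = 1 * ‖(P x' - P x).1‖ := by simp
        _ ≤ (τ x)⁻¹ * ‖P x' - P x‖ := by
          gcongr
          exact norm_fst_le _
    · rw [norm_smul, Real.norm_of_nonneg (by positivity)]
      gcongr
      exact norm_snd_le (P x' - P x)
  calc ε' * τ x * ‖η x' (τ x) - η x (τ x)‖
      ≤ ε' * τ x * (C * ((τ x)⁻¹ * (M * ‖x' - x‖))) := by
        gcongr
        exact k4.trans (by gcongr; exact k5.trans (by gcongr))
    _ = ε' * (C * M) * ‖x' - x‖ := by field_simp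
    _ ≤ ε' * (C * (M + 1)) * ‖x' - x‖ := by gcongr; linarith
    _ = ε * ‖x' - x‖ := by rw [hε']; field_simp

end Euclidean

/-! ### Conservation of energy. -/

section EulerLagrange

variable {V : Type*} [NormedAddCommGroup V] [NormedSpace ℝ V]

/-- Conservation of energy for the Euler-Lagrange equation of the energy, tested against the
velocity. -/
theorem hasDerivAt_energy {Φ : V × V × V → ℝ} {c : ℝ → V} {t : ℝ} (hc : ContDiffAt ℝ 2 c t)
    (hΦ : DifferentiableAt ℝ Φ (c t, deriv c t, deriv c t))
    (hsymm : ∀ y u w, Φ (y, u, w) = Φ (y, w, u))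
    (hEL : HasDerivAt (fun s => Φ (c s, deriv c s, deriv c t))
      ((1 / 2) * deriv (fun ε : ℝ => Φ (c t + ε • deriv c t, deriv c t, deriv c t)) 0) t) :
    HasDerivAt (fun s => Φ (c s, deriv c s, deriv c s)) 0 t := by
  have hc1 : HasDerivAt c (deriv c t) t := (hc.differentiableAt (by simp)).hasDerivAt
  have hc2 : HasDerivAt (deriv c) (deriv (deriv c) t) t :=
    ((hc.derivWithin (m := 1) (by norm_num)).differentiableAt (by simp)).hasDerivAt
  obtain ⟨D, hD⟩ := hΦ
  have e1 : HasDerivAt (fun s => Φ (c s, deriv c s, deriv c t))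
      (D (deriv c t, deriv (deriv c) t, 0)) t :=
    hD.comp_hasDerivAt t (f := fun s => (c s, deriv c s, deriv c t))
      (hc1.prodMk (hc2.prodMk (hasDerivAt_const t _)))
  have e2 : HasDerivAt (fun ε : ℝ => Φ (c t + ε • deriv c t, deriv c t, deriv c t))
      (D (deriv c t, 0, 0)) 0 := by
    have h3 : HasDerivAt (fun ε : ℝ => c t + ε • deriv c t) (deriv c t) 0 := by
      simpa using ((hasDerivAt_id (0 : ℝ)).smul_const (deriv c t)).const_add (c t)
    exact hD.comp_hasDerivAt_of_eq (0 : ℝ)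
      (f := fun ε : ℝ => (c t + ε • deriv c t, deriv c t, deriv c t))
      (h3.prodMk ((hasDerivAt_const _ _).prodMk (hasDerivAt_const _ _))) (by simp)
  have e3 : D (deriv c t, deriv (deriv c) t, 0) = 1 / 2 * D (deriv c t, 0, 0) := by
    rw [← e2.deriv]
    exact e1.unique hEL
  -- On the diagonal of the two velocity slots, invariance of `Φ` under their exchange passes to its
  -- derivative.
  have e4 : D (0, 0, deriv (deriv c) t) = D (0, deriv (deriv c) t, 0) := by
    set S : V × V × V →L[ℝ] V × V × V := (ContinuousLinearMap.fst ℝ _ _).prod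
      (((ContinuousLinearMap.snd ℝ _ _).comp (ContinuousLinearMap.snd ℝ _ _)).prod
      ((ContinuousLinearMap.fst ℝ _ _).comp (ContinuousLinearMap.snd ℝ _ _))) with hS
    have h3 : HasFDerivAt (Φ ∘ S) (D.comp S) (c t, deriv c t, deriv c t) :=
      HasFDerivAt.comp (g := Φ) (c t, deriv c t, deriv c t) hD S.hasFDerivAt
    have h4 : Φ ∘ S = Φ := by
      ext z
      exact hsymm _ _ _
    rw [h4] at h3
    have h5 := DFunLike.congr_fun (h3.unique hD) (0, 0, deriv (deriv c) t)
    simpa [hS] using h5.symm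
  have h3 : HasDerivAt (fun s => Φ (c s, deriv c s, deriv c s))
      (D (deriv c t, deriv (deriv c) t, deriv (deriv c) t)) t :=
    hD.comp_hasDerivAt t (f := fun s => (c s, deriv c s, deriv c s))
      (hc1.prodMk (hc2.prodMk hc2))
  convert h3 using 1
  -- With a = D(c', 0, 0) and b = D(0, c'', 0), the Euler-Lagrange equation reads a + b = a / 2, and
  -- the derivative of the energy is a + 2b = 0.
  have h4 : ((deriv c t, deriv (deriv c) t, deriv (deriv c) t) : V × V × V) =
    (deriv c t, deriv (deriv c) t, 0) + (0, 0, deriv (deriv c) t) := by simp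
  have h5 : ((deriv c t, deriv (deriv c) t, 0) : V × V × V) =
    (deriv c t, 0, 0) + (0, deriv (deriv c) t, 0) := by simp
  have h6 := e3
  rw [h5, map_add] at h6
  rw [h4, map_add, e4, e3]
  linarith

end EulerLagrange

/-! ### Constant speed of geodesics and the exponential of zero vectors. -/

section ZeroVelocity

variable {n : ℕ} {M : Type u} [MetricSpace M] [ChartedSpace (Model n) M]
  [IsManifold (𝓡 n) ∞ M]

theorem contMDiff_tangentBundle_mk {V : Type*} [NormedAddCommGroup V] [NormedSpace ℝ V] :
    ContMDiff 𝓘(ℝ, V × V) 𝓘(ℝ, V).tangent ∞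
      (fun z : V × V => (⟨z.1, z.2⟩ : TangentBundle 𝓘(ℝ, V) V)) := by
  intro z
  rw [contMDiffAt_totalSpace]
  refine ⟨contDiff_fst.contMDiff.contMDiffAt, ?_⟩
  simp only [trivializationAt_model_space_apply]
  exact contDiff_snd.contMDiff.contMDiffAt

/-- Coordinate vectors, as tangent vectors of `M`, depend smoothly on base point and components. -/
theorem contMDiffOn_mfderiv_extChartAt_symm (x₀ : M) :
    ContMDiffOn 𝓘(ℝ, Model n × Model n) (𝓡 n).tangent ∞
      (fun z : Model n × Model n => (⟨(extChartAt (𝓡 n) x₀).symm z.1,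
        mfderiv 𝓘(ℝ, Model n) (𝓡 n) (extChartAt (𝓡 n) x₀).symm z.1 z.2⟩ : TangentBundle (𝓡 n) M))
      ((extChartAt (𝓡 n) x₀).target ×ˢ univ) := by
  have ho : IsOpen (extChartAt (𝓡 n) x₀).target := isOpen_extChartAt_target x₀
  have h1 := (contMDiffOn_extChartAt_symm (I := 𝓡 n) (n := ∞) x₀).contMDiffOn_tangentMapWithin
    (m := ∞) (by norm_num) ho.uniqueMDiffOn
  have h2 := h1.comp (contMDiff_tangentBundle_mk (V := Model n)).contMDiffOn
    (s := (extChartAt (𝓡 n) x₀).target ×ˢ univ) (fun z hz => hz.1)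
  refine h2.congr fun z hz => ?_
  simp only [Function.comp_def, tangentMapWithin]
  rw [mfderivWithin_of_mem_nhds (ho.mem_nhds hz.1)]

variable [RiemannianBundle (fun x : M => TangentSpace (𝓡 n) x)]

omit [IsManifold (𝓡 n) ∞ M] in
theorem chartMetric_symm (x₀ : M) (y u w : Model n) :
    chartMetric x₀ y u w = chartMetric x₀ y w u :=
  real_inner_comm _ _

variable [IsContMDiffRiemannianBundle (𝓡 n) ∞ (Model n) (fun x : M => TangentSpace (𝓡 n) x)]

theorem contDiffAt_chartMetric (x₀ : M) {z : Model n × Model n × Model n}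
    (hz : z.1 ∈ (extChartAt (𝓡 n) x₀).target) :
    ContDiffAt ℝ ∞ (fun z : Model n × Model n × Model n => chartMetric x₀ z.1 z.2.1 z.2.2) z := by
  have ho : IsOpen (extChartAt (𝓡 n) x₀).target := isOpen_extChartAt_target x₀
  rw [← contMDiffAt_iff_contDiffAt]
  have h0 : ∀ z' : Model n × Model n, z'.1 ∈ (extChartAt (𝓡 n) x₀).target → _ := fun z' hz' =>
    (contMDiffOn_mfderiv_extChartAt_symm x₀).contMDiffAt
      ((ho.prod isOpen_univ).mem_nhds (⟨hz', trivial⟩ : z' ∈ _ ×ˢ univ))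
  have h1 := (h0 (z.1, z.2.1) hz).comp z (f := fun z : Model n × Model n × Model n => (z.1, z.2.1))
    (ContDiff.contMDiff (by fun_prop)).contMDiffAt
  have h2 := (h0 (z.1, z.2.2) hz).comp z (f := fun z : Model n × Model n × Model n => (z.1, z.2.2))
    (ContDiff.contMDiff (by fun_prop)).contMDiffAt
  exact ContMDiffAt.inner_bundle h1 h2

/-- Geodesics have constant speed. -/
theorem IsGeodesic.hasDerivAt_inner_velocity {γ : ℝ → M} (hγ : IsGeodesic (n := n) γ) (t : ℝ) :
    HasDerivAt (fun s => (inner ℝ (velocity n γ s).2 (velocity n γ s).2 : ℝ)) 0 t := by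
  obtain ⟨hsm, hEL⟩ := hγ
  have hsrc : γ t ∈ (chartAt (Model n) (γ t)).source := mem_chart_source _ _
  have hγs : ∀ᶠ s in 𝓝 t, γ s ∈ (extChartAt (𝓡 n) (γ t)).source :=
    hsm.continuous.continuousAt.eventually (extChartAt_source_mem_nhds _)
  have hcs : ∀ᶠ s in 𝓝 t, ContDiffAt ℝ 2 (fun a => extChartAt (𝓡 n) (γ t) (γ a)) s := by
    filter_upwards [hγs] with s hs
    rw [extChartAt_source] at hs
    rw [← contMDiffAt_iff_contDiffAt]
    exact ((contMDiffAt_extChartAt' hs).comp s hsm.contMDiffAt).of_le (by norm_cast)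
  have hct : extChartAt (𝓡 n) (γ t) (γ t) ∈ (extChartAt (𝓡 n) (γ t)).target :=
    (extChartAt (𝓡 n) (γ t)).map_source (mem_extChartAt_source _)
  have key := hasDerivAt_energy
    (Φ := fun z : Model n × Model n × Model n => chartMetric (γ t) z.1 z.2.1 z.2.2)
    hcs.self_of_nhds ((contDiffAt_chartMetric (γ t) hct).differentiableAt (by simp))
    (fun y u w => chartMetric_symm (γ t) y u w) (hEL (γ t) t hsrc _)
  refine key.congr_of_eventuallyEq ?_
  filter_upwards [hγs.eventually_nhds, hcs] with s hs hcs
  -- Chain rule through the chart: the coordinate energy near `t` is the squared speed of `γ`.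
  have hv : (⟨(extChartAt (𝓡 n) (γ t)).symm (extChartAt (𝓡 n) (γ t) (γ s)),
      mfderiv 𝓘(ℝ, Model n) (𝓡 n) (extChartAt (𝓡 n) (γ t)).symm (extChartAt (𝓡 n) (γ t) (γ s))
        (deriv (fun a => extChartAt (𝓡 n) (γ t) (γ a)) s)⟩ : TangentBundle (𝓡 n) M) =
      velocity n γ s := by
    have hs' : extChartAt (𝓡 n) (γ t) (γ s) ∈ (extChartAt (𝓡 n) (γ t)).target :=
      (extChartAt (𝓡 n) (γ t)).map_source hs.self_of_nhds
    have heq : γ =ᶠ[𝓝 s] (extChartAt (𝓡 n) (γ t)).symm ∘ (fun a => extChartAt (𝓡 n) (γ t) (γ a)) := by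
      filter_upwards [hs] with a ha using ((extChartAt (𝓡 n) (γ t)).left_inv ha).symm
    have hd : MDifferentiableAt 𝓘(ℝ, Model n) (𝓡 n) (extChartAt (𝓡 n) (γ t)).symm
        (extChartAt (𝓡 n) (γ t) (γ s)) :=
      ((contMDiffOn_extChartAt_symm (I := 𝓡 n) (n := ∞) (γ t)).contMDiffAt
        ((isOpen_extChartAt_target (γ t)).mem_nhds hs')).mdifferentiableAt (by simp)
    have h1 := heq.mfderiv_eq (I := 𝓘(ℝ, ℝ)) (I' := 𝓡 n)
    rw [mfderiv_comp s hd (hcs.differentiableAt (by simp)).mdifferentiableAt] at h1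
    refine Bundle.TotalSpace.ext heq.self_of_nhds.symm (heq_of_eq ?_)
    have h2 := DFunLike.congr_fun h1 (1 : ℝ)
    refine Eq.trans ?_ h2.symm
    rw [mfderiv_eq_fderiv]
    rfl
  exact congrArg (fun v : TangentBundle (𝓡 n) M => (inner ℝ v.2 v.2 : ℝ)) hv.symm

variable [IsRiemannianManifold (𝓡 n) M]

/-- Constant speed zero gives length zero, hence Riemannian distance zero between `γ 0` and `γ t`.
Uniqueness of geodesics is not involved. -/
theorem IsGeodesic.eq_of_velocity_eq_zero {γ : ℝ → M} (hγ : IsGeodesic (n := n) γ)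
    (h0 : (velocity n γ 0).2 = 0) (t : ℝ) (ht : 0 ≤ t) : γ t = γ 0 := by
  have hconst : ∀ s, (inner ℝ (velocity n γ s).2 (velocity n γ s).2 : ℝ) = 0 := fun s => by
    rw [is_const_of_deriv_eq_zero (fun s => (hγ.hasDerivAt_inner_velocity s).differentiableAt)
      (fun s => (hγ.hasDerivAt_inner_velocity s).deriv) s 0, h0, inner_zero_left]
  have hz : ∀ s, mfderiv 𝓘(ℝ, ℝ) (𝓡 n) γ s (1 : ℝ) = 0 := fun s => inner_self_eq_zero.1 (hconst s)
  have h1 : riemannianEDist (𝓡 n) (γ 0) (γ t) ≤ pathELength (𝓡 n) γ 0 t :=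
    riemannianEDist_le_pathELength (hγ.1.of_le (by norm_cast)).contMDiffOn rfl rfl ht
  have h2 : pathELength (𝓡 n) γ 0 t = 0 := by
    rw [pathELength_eq_lintegral_mfderiv_Icc]
    refine (MeasureTheory.lintegral_congr fun s => ?_).trans MeasureTheory.lintegral_zero
    exact (congrArg enorm (hz s)).trans enorm_zero
  rw [h2, ← IsRiemannianManifold.out (I := 𝓡 n)] at h1
  exact (edist_le_zero.1 h1).symm

/-- Whichever geodesic the definition chooses is constant on nonnegative times, and the default
value is the base point too. This is what places S at the zero section of the tube. -/
theorem expMap_zero (q : M) : expMap (⟨q, 0⟩ : TangentBundle (𝓡 n) M) = q := by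
  unfold expMap
  split_ifs with hv
  · obtain ⟨hγ, h0⟩ := hv.choose_spec
    have h1 : hv.choose 0 = q := congrArg Bundle.TotalSpace.proj h0
    have h2 : (velocity n hv.choose 0).2 = 0 := by
      rw [h0]
    rw [hγ.eq_of_velocity_eq_zero h2 1 zero_le_one, h1]
  · rfl

end ZeroVelocity

/-! ### Velocities, tangent maps and scaling in the fibres. -/

section TangentMaps

variable {n : ℕ} {M : Type u} [TopologicalSpace M] [ChartedSpace (Model n) M]

theorem tangentMap_congr_of_eventuallyEq {E H E' H' N N' : Type*}
    [NormedAddCommGroup E] [NormedSpace ℝ E] [TopologicalSpace H] {I : ModelWithCorners ℝ E H}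
    [TopologicalSpace N] [ChartedSpace H N]
    [NormedAddCommGroup E'] [NormedSpace ℝ E'] [TopologicalSpace H'] {I' : ModelWithCorners ℝ E' H'}
    [TopologicalSpace N'] [ChartedSpace H' N'] {f g : N → N'} {p : TangentBundle I N}
    (h : f =ᶠ[𝓝 p.1] g) : tangentMap I I' f p = tangentMap I I' g p :=
  Bundle.TotalSpace.ext h.self_of_nhds
    (heq_of_eq (DFunLike.congr_fun (h.mfderiv_eq (I := I) (I' := I')) p.2))

theorem velocity_comp {γ : ℝ → M} {f : M → M} {t : ℝ}
    (hf : MDifferentiableAt (𝓡 n) (𝓡 n) f (γ t)) (hγ : MDifferentiableAt 𝓘(ℝ, ℝ) (𝓡 n) γ t) :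
    velocity n (f ∘ γ) t = tangentMap (𝓡 n) (𝓡 n) f (velocity n γ t) :=
  tangentMap_comp_at (⟨t, (1 : ℝ)⟩ : TangentBundle 𝓘(ℝ, ℝ) ℝ) hf hγ

/-- The curve is a straight line in the chart. Since `tangentSpaceOf` is defined by curves, this
lets tangent maps produce elements of it. -/
theorem exists_velocity_eq [IsManifold (𝓡 n) ∞ M] (v : TangentBundle (𝓡 n) M) :
    ∃ c : ℝ → M, ContMDiffAt 𝓘(ℝ, ℝ) (𝓡 n) ∞ c 0 ∧ velocity n c 0 = v := by
  set φ := extChartAt (𝓡 n) v.proj with hφ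
  set w : Model n := mfderiv (𝓡 n) 𝓘(ℝ, Model n) φ v.proj v.2 with hw
  set ℓ : ℝ → Model n := fun s => φ v.proj + s • w with hℓ
  have hℓ0 : ℓ 0 = φ v.proj := by simp [hℓ]
  have hℓs : ContMDiff 𝓘(ℝ, ℝ) 𝓘(ℝ, Model n) ∞ ℓ := ContDiff.contMDiff (by fun_prop)
  have hsymm : ContMDiffAt 𝓘(ℝ, Model n) (𝓡 n) ∞ φ.symm (φ v.proj) :=
    (contMDiffOn_extChartAt_symm v.proj).contMDiffAt (extChartAt_target_mem_nhds _)
  have hφs : ContMDiffAt (𝓡 n) 𝓘(ℝ, Model n) ∞ φ v.proj := contMDiffAt_extChartAt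
  refine ⟨φ.symm ∘ ℓ, ContMDiffAt.comp (0 : ℝ) (by rwa [hℓ0]) hℓs.contMDiffAt, ?_⟩
  have h1 : velocity n (φ.symm ∘ ℓ) 0 = tangentMap 𝓘(ℝ, Model n) (𝓡 n) φ.symm
      (tangentMap 𝓘(ℝ, ℝ) 𝓘(ℝ, Model n) ℓ (⟨0, (1 : ℝ)⟩ : TangentBundle 𝓘(ℝ, ℝ) ℝ)) :=
    tangentMap_comp_at (⟨0, (1 : ℝ)⟩ : TangentBundle 𝓘(ℝ, ℝ) ℝ)
      (by rw [hℓ0]; exact hsymm.mdifferentiableAt (by simp))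
      (hℓs.contMDiffAt.mdifferentiableAt (by simp))
  have h2 : tangentMap 𝓘(ℝ, ℝ) 𝓘(ℝ, Model n) ℓ (⟨0, (1 : ℝ)⟩ : TangentBundle 𝓘(ℝ, ℝ) ℝ) =
      tangentMap (𝓡 n) 𝓘(ℝ, Model n) φ v := by
    refine Bundle.TotalSpace.ext hℓ0 (heq_of_eq ?_)
    have h3 : HasDerivAt ℓ w 0 := by
      simpa [hℓ] using ((hasDerivAt_id (0 : ℝ)).smul_const w)
    change mfderiv 𝓘(ℝ, ℝ) 𝓘(ℝ, Model n) ℓ 0 (1 : ℝ) = w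
    rw [mfderiv_eq_fderiv]
    exact h3.deriv
  rw [h1, h2, ← tangentMap_comp_at v (hsymm.mdifferentiableAt (by simp))
    (hφs.mdifferentiableAt (by simp)), tangentMap_congr_of_eventuallyEq (g := id), tangentMap_id]
  · rfl
  · filter_upwards [extChartAt_source_mem_nhds (I := 𝓡 n) v.proj] with x hx using φ.left_inv hx

@[simp] theorem scale_proj (t : ℝ) (v : TangentBundle (𝓡 n) M) : (scale t v).proj = v.proj := rfl

theorem scale_scale (s t : ℝ) (v : TangentBundle (𝓡 n) M) :
    scale s (scale t v) = scale (s * t) v :=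
  Bundle.TotalSpace.ext rfl (heq_of_eq (smul_smul s t v.2))

theorem scale_one (v : TangentBundle (𝓡 n) M) : scale 1 v = v :=
  Bundle.TotalSpace.ext rfl (heq_of_eq (one_smul ℝ v.2))

theorem scale_zero (v : TangentBundle (𝓡 n) M) : scale 0 v = ⟨v.proj, 0⟩ :=
  Bundle.TotalSpace.ext rfl (heq_of_eq (zero_smul ℝ v.2))

variable [IsManifold (𝓡 n) ∞ M]

theorem trivializationAt_scale {q : M} (t : ℝ) {v : TangentBundle (𝓡 n) M}
    (hv : v.proj ∈ (trivializationAt (Model n) (TangentSpace (𝓡 n) : M → Type _) q).baseSet) :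
    (trivializationAt (Model n) (TangentSpace (𝓡 n) : M → Type _) q (scale t v)).2 =
      t • (trivializationAt (Model n) (TangentSpace (𝓡 n) : M → Type _) q v).2 :=
  ((trivializationAt (Model n) (TangentSpace (𝓡 n) : M → Type _) q).linear ℝ hv).map_smul t v.2

theorem contMDiff_scale :
    ContMDiff (𝓘(ℝ, ℝ).prod (𝓡 n).tangent) (𝓡 n).tangent ∞
      (fun z : ℝ × TangentBundle (𝓡 n) M => scale z.1 z.2) := by
  intro z
  have hproj : ContMDiff (𝓘(ℝ, ℝ).prod (𝓡 n).tangent) (𝓡 n) ∞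
      (fun z : ℝ × TangentBundle (𝓡 n) M => z.2.proj) :=
    (contMDiff_proj (TangentSpace (𝓡 n) : M → Type _)).comp contMDiff_snd
  rw [contMDiffAt_totalSpace]
  refine ⟨hproj.contMDiffAt, ?_⟩
  have h1 := (contMDiffAt_totalSpace.1 (contMDiff_snd (I := 𝓘(ℝ, ℝ)) (J := (𝓡 n).tangent) (n := ∞)
    (M := ℝ) (N := TangentBundle (𝓡 n) M) z)).2
  refine ((contMDiff_fst.contMDiffAt (x := z)).smul h1).congr_of_eventuallyEq ?_
  have hb : ∀ᶠ z' : ℝ × TangentBundle (𝓡 n) M in 𝓝 z, z'.2.proj ∈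
      (trivializationAt (Model n) (TangentSpace (𝓡 n) : M → Type _) z.2.proj).baseSet :=
    hproj.continuous.continuousAt.eventually
      ((trivializationAt (Model n) (TangentSpace (𝓡 n) : M → Type _) z.2.proj).open_baseSet.mem_nhds
        (mem_baseSet_trivializationAt _ _ _))
  filter_upwards [hb] with z' hz'
  exact trivializationAt_scale z'.1 hz'

end TangentMaps

/-! ### Closedness of the normal bundle over S, from the retraction. -/

section Tubular

variable {n : ℕ} {M : Type u} [MetricSpace M] [ChartedSpace (Model n) M]
  [IsManifold (𝓡 n) ∞ M] [RiemannianBundle (fun x : M => TangentSpace (𝓡 n) x)]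

/-- `J` is the inverse of the normal exponential map of `S`, for a tubular radius `r`. -/
structure IsTubularInverse (S : Set M) (r : ℝ) (J : M → TangentBundle (𝓡 n) M) : Prop where
  pos : 0 < r
  contMDiffOn_exp : ContMDiffOn (𝓡 n).tangent (𝓡 n) ∞ (expMap (n := n) (M := M)) (normalDisc S r)
  contMDiffOn : ContMDiffOn (𝓡 n) (𝓡 n).tangent ∞ J (Metric.thickening r S)
  mapsTo_exp : MapsTo expMap (normalDisc (n := n) S r) (Metric.thickening r S)
  mapsTo : MapsTo J (Metric.thickening r S) (normalDisc S r)
  invOn : InvOn J expMap (normalDisc S r) (Metric.thickening r S)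

theorem IsTubularRadius.exists_isTubularInverse {S : Set M} {r : ℝ} (hr : IsTubularRadius n S r) :
    ∃ J : M → TangentBundle (𝓡 n) M, IsTubularInverse S r J :=
  let ⟨h0, h1, J, h2, h3, h4, h5⟩ := hr
  ⟨J, h0, h1, h2, h3, h4, h5⟩

omit [IsManifold (𝓡 n) ∞ M] in
theorem scale_mem_normalBundle {S : Set M} {v : TangentBundle (𝓡 n) M} (hv : v ∈ normalBundle S)
    (t : ℝ) : scale t v ∈ normalBundle S :=
  ⟨hv.1, Submodule.smul_mem _ t hv.2⟩

omit [RiemannianBundle (fun x : M => TangentSpace (𝓡 n) x)] in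
/-- A smooth map with values in `S` maps tangent vectors to vectors tangent to `S`. -/
theorem tangentMap_mem_tangentSpaceOf {S : Set M} {f : M → M} {z : TangentBundle (𝓡 n) M}
    (hf : ContMDiffAt (𝓡 n) (𝓡 n) ∞ f z.proj) (hS : ∀ᶠ x in 𝓝 z.proj, f x ∈ S) {q : M}
    {u : TangentSpace (𝓡 n) q} (hu : tangentMap (𝓡 n) (𝓡 n) f z = ⟨q, u⟩) :
    u ∈ tangentSpaceOf (n := n) S q := by
  obtain ⟨c, hc, hcz⟩ := exists_velocity_eq z
  have hc0 : c 0 = z.proj := congrArg Bundle.TotalSpace.proj hcz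
  rw [← hc0] at hf hS
  refine Submodule.subset_span ⟨f ∘ c, hf.comp (0 : ℝ) hc, hc.continuousAt.eventually hS, ?_⟩
  rw [velocity_comp (hf.mdifferentiableAt (by simp)) (hc.mdifferentiableAt (by simp)), hcz, hu]

-- `f` fixes every curve inside `S`, hence its velocity; linearity extends this to the span. The
-- equation lives in `Model n` because `f q` and `q` are not definitionally equal.
omit [IsManifold (𝓡 n) ∞ M] [RiemannianBundle (fun x : M => TangentSpace (𝓡 n) x)] in
theorem mfderiv_apply_eq_of_mem_tangentSpaceOf {S : Set M} {f : M → M} {q : M}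
    (hf : MDifferentiableAt (𝓡 n) (𝓡 n) f q) (hS : ∀ x ∈ S, f x = x)
    {u : TangentSpace (𝓡 n) q} (hu : u ∈ tangentSpaceOf (n := n) S q) :
    (mfderiv (𝓡 n) (𝓡 n) f q u : Model n) = u := by
  induction hu using Submodule.span_induction with
  | mem u hu =>
    obtain ⟨c, hc, hcS, hcu⟩ := hu
    have hc0 : c 0 = q := congrArg Bundle.TotalSpace.proj hcu
    have h1 : velocity n (f ∘ c) 0 = velocity n c 0 :=
      tangentMap_congr_of_eventuallyEq (p := (⟨0, (1 : ℝ)⟩ : TangentBundle 𝓘(ℝ, ℝ) ℝ))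
        (hcS.mono fun t ht => hS _ ht)
    rw [velocity_comp (by rwa [hc0]) (hc.mdifferentiableAt (by simp)), hcu] at h1
    exact eq_of_heq (Bundle.TotalSpace.ext_iff.1 h1).2
  | zero => exact map_zero (mfderiv (𝓡 n) (𝓡 n) f q)
  | add u v _ _ hu hv =>
    exact (map_add (mfderiv (𝓡 n) (𝓡 n) f q) u v).trans (congrArg₂ (fun a b : Model n => a + b) hu hv)
  | smul t u _ hu =>
    exact (map_smul (mfderiv (𝓡 n) (𝓡 n) f q) t u).trans (congrArg (fun a : Model n => t • a) hu)

omit [IsManifold (𝓡 n) ∞ M] [RiemannianBundle (fun x : M => TangentSpace (𝓡 n) x)] in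
theorem eq_of_mk_heq {q q' : M} (h : q' = q) (u : Model n) :
    (⟨q, (u : TangentSpace (𝓡 n) q)⟩ : TangentBundle (𝓡 n) M) =
      ⟨q', (u : TangentSpace (𝓡 n) q')⟩ := by
  subst h
  rfl

variable [IsContMDiffRiemannianBundle (𝓡 n) ∞ (Model n) (fun x : M => TangentSpace (𝓡 n) x)]

/-- A smooth Riemannian metric is continuous. -/
theorem isContinuousRiemannianBundle_tangentSpace :
    IsContinuousRiemannianBundle (Model n) (fun x : M => TangentSpace (𝓡 n) x) := by
  obtain ⟨g, hg, hg'⟩ := IsContMDiffRiemannianBundle.exists_contMDiff (IB := 𝓡 n) (n := ∞)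
    (F := Model n) (E := fun x : M => TangentSpace (𝓡 n) x)
  exact ⟨g, hg.continuous, hg'⟩

/-- If `S` has a smooth retraction then limits of normal vectors based at points of `S`
are normal. -/
theorem mem_normalBundle_of_mem_closure {S B : Set M} (hB : IsOpen B) (hSB : S ⊆ B) {f : M → M}
    (hf : ContMDiffOn (𝓡 n) (𝓡 n) ∞ f B) (hfS : MapsTo f B S) (hf' : ∀ x ∈ S, f x = x)
    {v : TangentBundle (𝓡 n) M} (hv : v ∈ closure (normalBundle S)) (hvS : v.proj ∈ S) :
    v ∈ normalBundle S := by
  have := isContinuousRiemannianBundle_tangentSpace (n := n) (M := M)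
  refine ⟨hvS, (Submodule.mem_orthogonal _ _).2 fun u hu => ?_⟩
  set e := trivializationAt (Model n) (TangentSpace (𝓡 n) : M → Type _) v.proj with he
  set uu : TangentBundle (𝓡 n) M := ⟨v.proj, u⟩ with huu
  -- `Z` extends `u` with constant fibre coordinate. Its image under the differential of `f` is
  -- tangent to `S` over points of `S`, and equals `u` over `v`. So the pairing with normal vectors
  -- near `v` vanishes, and continuity carries this to the limit `v`.
  set Z : TangentBundle (𝓡 n) M → TangentBundle (𝓡 n) M :=
    fun w => e.toOpenPartialHomeomorph.symm (w.proj, (e uu).2) with hZ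
  have hvb : v.proj ∈ e.baseSet := mem_baseSet_trivializationAt _ _ _
  have hZv : Z v = uu := e.symm_apply_mk_proj (x := uu) (e.mem_source.2 hvb)
  have hproj : Continuous (fun w : TangentBundle (𝓡 n) M => w.proj) :=
    FiberBundle.continuous_proj (Model n) (TangentSpace (𝓡 n) : M → Type _)
  have hZc : ContinuousAt Z v := by
    refine ContinuousAt.comp (f := fun w : TangentBundle (𝓡 n) M => (w.proj, (e uu).2))
      (e.toOpenPartialHomeomorph.continuousAt_symm ?_) (by fun_prop)
    exact e.mem_target.2 hvb
  have hTc : ContinuousAt (tangentMap (𝓡 n) (𝓡 n) f) uu := by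
    have h1 := (hf.continuousOn_tangentMapWithin (by simp) hB.uniqueMDiffOn).continuousAt
      ((hB.preimage hproj).mem_nhds (hSB hvS : uu ∈ _))
    refine h1.congr ?_
    filter_upwards [(hB.preimage hproj).mem_nhds (hSB hvS : uu ∈ _)] with w hw
    simp only [tangentMapWithin, tangentMap]
    rw [mfderivWithin_of_mem_nhds (hB.mem_nhds hw)]
  have hTu : tangentMap (𝓡 n) (𝓡 n) f uu = uu :=
    (eq_of_mk_heq (hf' _ hvS) _).symm.trans (congrArg (fun a : Model n =>
      (⟨v.proj, (a : TangentSpace (𝓡 n) v.proj)⟩ : TangentBundle (𝓡 n) M))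
      (mfderiv_apply_eq_of_mem_tangentSpaceOf
        ((hf.contMDiffAt (hB.mem_nhds (hSB hvS))).mdifferentiableAt (by simp)) hf' hu))
  -- The vector is rebased from `f (Z w).proj` to `w.proj`, so that its inner product with `w.2`
  -- makes sense; over `S`, within the base set of `e`, the two base points agree.
  set W : ∀ w : TangentBundle (𝓡 n) M, TangentSpace (𝓡 n) w.proj :=
    fun w => ((tangentMap (𝓡 n) (𝓡 n) f (Z w)).2 : Model n) with hW
  have hWeq : ∀ w : TangentBundle (𝓡 n) M, w.proj ∈ S → w.proj ∈ e.baseSet →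
      (⟨w.proj, W w⟩ : TangentBundle (𝓡 n) M) = tangentMap (𝓡 n) (𝓡 n) f (Z w) := fun w hw hwe => by
    have h2 : f (Z w).proj = w.proj := by
      rw [hZ, e.proj_symm_apply' hwe, hf' _ hw]
    exact eq_of_mk_heq h2 _
  have hev : ∀ᶠ w in 𝓝 v, w.proj ∈ e.baseSet :=
    hproj.continuousAt.eventually (e.open_baseSet.mem_nhds hvb)
  have hWv : W v = u := by
    have h3 := (hWeq v hvS hvb).trans ((congrArg _ hZv).trans hTu)
    exact eq_of_heq (Bundle.TotalSpace.ext_iff.1 h3).2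
  have hWc : ContinuousWithinAt (fun w => (⟨w.proj, W w⟩ : TangentBundle (𝓡 n) M))
      (normalBundle S) v := by
    have h4 : ContinuousWithinAt (fun w => tangentMap (𝓡 n) (𝓡 n) f (Z w)) (normalBundle S) v :=
      (ContinuousAt.comp (f := Z) (g := tangentMap (𝓡 n) (𝓡 n) f) (by rwa [hZv]) hZc).continuousWithinAt
    refine h4.congr_of_eventuallyEq ?_ (hWeq v hvS hvb)
    filter_upwards [self_mem_nhdsWithin, mem_nhdsWithin_of_mem_nhds hev] with w hw hwe
    exact hWeq w hw.1 hwe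
  have hin : ContinuousWithinAt (fun w => (inner ℝ (W w) w.2 : ℝ)) (normalBundle S) v :=
    ContinuousWithinAt.inner_bundle (F := Model n) hWc continuousWithinAt_id
  have hzero : ∀ᶠ w in 𝓝[normalBundle S] v, (inner ℝ (W w) w.2 : ℝ) = 0 := by
    filter_upwards [self_mem_nhdsWithin, mem_nhdsWithin_of_mem_nhds hev] with w hw hwe
    have hZw : (Z w).proj = w.proj := e.proj_symm_apply' hwe
    have hBw : B ∈ 𝓝 (Z w).proj := by
      rw [hZw]
      exact hB.mem_nhds (hSB hw.1)
    exact (Submodule.mem_orthogonal _ _).1 hw.2 _ (tangentMap_mem_tangentSpaceOf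
      (hf.contMDiffAt hBw) (by filter_upwards [hBw] with x hx using hfS hx) (hWeq w hw.1 hwe).symm)
  have := mem_closure_iff_nhdsWithin_neBot.1 hv
  have hlim : (inner ℝ (W v) v.2 : ℝ) = 0 := tendsto_nhds_unique hin (tendsto_const_nhds.congr' (hzero.mono fun _ h => h.symm))
  rwa [hWv] at hlim

end Tubular

/-! ### Charts of the tangent bundle, in which scaling acts on the second component. -/

section TangentChart

variable {n : ℕ} {M : Type u} [TopologicalSpace M] [ChartedSpace (Model n) M]
  [IsManifold (𝓡 n) ∞ M]

/-- The chart of the tangent bundle over the preferred chart at `q₀`. -/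
def tangentChart (q₀ : M) : PartialEquiv (TangentBundle (𝓡 n) M) (Model n × Model n) :=
  extChartAt (𝓡 n).tangent (⟨q₀, 0⟩ : TangentBundle (𝓡 n) M)

theorem tangentChart_apply (q₀ : M) (v : TangentBundle (𝓡 n) M) :
    tangentChart q₀ v = (extChartAt (𝓡 n) q₀ v.proj,
      (trivializationAt (Model n) (TangentSpace (𝓡 n) : M → Type _) q₀ v).2) := by
  unfold tangentChart
  rw [FiberBundle.extChartAt]
  rfl

theorem mem_tangentChart_source {q₀ : M} {v : TangentBundle (𝓡 n) M} :
    v ∈ (tangentChart q₀).source ↔ v.proj ∈ (chartAt (Model n) q₀).source := by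
  unfold tangentChart
  rw [extChartAt_source, TangentBundle.mem_chart_source_iff]

theorem contMDiffAt_tangentChart {q₀ : M} {v : TangentBundle (𝓡 n) M}
    (hv : v.proj ∈ (chartAt (Model n) q₀).source) :
    ContMDiffAt (𝓡 n).tangent 𝓘(ℝ, Model n × Model n) ∞ (tangentChart q₀) v :=
  contMDiffAt_extChartAt' (by rwa [TangentBundle.mem_chart_source_iff])

theorem contMDiffAt_tangentChart_symm {q₀ : M} {v : TangentBundle (𝓡 n) M}
    (hv : v.proj ∈ (chartAt (Model n) q₀).source) :
    ContMDiffAt 𝓘(ℝ, Model n × Model n) (𝓡 n).tangent ∞ (tangentChart q₀).symm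
      (tangentChart q₀ v) :=
  (contMDiffOn_extChartAt_symm (⟨q₀, 0⟩ : TangentBundle (𝓡 n) M)).contMDiffAt
    ((isOpen_extChartAt_target _).mem_nhds
      ((tangentChart q₀).map_source (mem_tangentChart_source.2 hv)))

theorem tangentChart_scale {q₀ : M} (t : ℝ) {v : TangentBundle (𝓡 n) M}
    (hv : v.proj ∈ (chartAt (Model n) q₀).source) :
    tangentChart q₀ (scale t v) = ((tangentChart q₀ v).1, t • (tangentChart q₀ v).2) := by
  rw [tangentChart_apply, tangentChart_apply, trivializationAt_scale t (by exact hv), scale_proj]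

theorem tangentChart_mk_zero {q₀ q : M} (hq : q ∈ (chartAt (Model n) q₀).source) :
    tangentChart q₀ (⟨q, 0⟩ : TangentBundle (𝓡 n) M) = (extChartAt (𝓡 n) q₀ q, 0) := by
  have h1 := tangentChart_scale (n := n) 0 (v := ⟨q, 0⟩) hq
  rw [scale_zero, zero_smul, tangentChart_apply] at h1
  rw [tangentChart_apply, h1]

theorem tangentChart_snd_eq_zero_iff {q₀ : M} {v : TangentBundle (𝓡 n) M}
    (hv : v.proj ∈ (chartAt (Model n) q₀).source) : (tangentChart q₀ v).2 = 0 ↔ v.2 = 0 := by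
  have h1 : tangentChart q₀ (⟨v.proj, 0⟩ : TangentBundle (𝓡 n) M) = ((tangentChart q₀ v).1, 0) := by
    rw [tangentChart_mk_zero hv, tangentChart_apply q₀ v]
  constructor
  · intro h
    have h2 : v = ⟨v.proj, 0⟩ := (tangentChart q₀).injOn (mem_tangentChart_source.2 hv)
      (mem_tangentChart_source.2 (by exact hv)) (by rw [h1, ← h])
    exact eq_of_heq (Bundle.TotalSpace.ext_iff.1 h2).2
  · intro h
    have h2 : v = ⟨v.proj, 0⟩ := Bundle.TotalSpace.ext rfl (heq_of_eq h)
    rw [h2, h1]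

end TangentChart

theorem smul_mem_submodule_mk {K V : Type*} [DivisionRing K] [AddCommGroup V] [Module K V]
    (v : V) (hv : v ≠ 0) (a : K) : a • v ∈ (Projectivization.mk K v hv).submodule := by
  rw [Projectivization.submodule_mk]
  exact Submodule.mem_span_singleton.2 ⟨a, rfl⟩

/-! ### The tubular inverse, and smoothness of dilations through the blow-up. -/

section Tubular

variable {n : ℕ} {M : Type u} [MetricSpace M] [ChartedSpace (Model n) M]
  [IsManifold (𝓡 n) ∞ M] [RiemannianBundle (fun x : M => TangentSpace (𝓡 n) x)]

namespace IsTubularInverse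

variable {S : Set M} {r : ℝ} {J : M → TangentBundle (𝓡 n) M} (hT : IsTubularInverse S r J)
include hT

theorem subset_thickening : S ⊆ Metric.thickening r S := Metric.self_subset_thickening hT.pos S

theorem contMDiffOn_proj :
    ContMDiffOn (𝓡 n) (𝓡 n) ∞ (fun x => (J x).proj) (Metric.thickening r S) :=
  (contMDiff_proj (TangentSpace (𝓡 n) : M → Type _)).comp_contMDiffOn hT.contMDiffOn

theorem mapsTo_proj : MapsTo (fun x => (J x).proj) (Metric.thickening r S) S :=
  fun _ hx => (hT.mapsTo hx).1.1

theorem scale_mem_normalDisc {x : M} (hx : x ∈ Metric.thickening r S) {t : ℝ}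
    (ht : ‖(scale t (J x)).2‖ < r) : scale t (J x) ∈ normalDisc S r :=
  ⟨scale_mem_normalBundle (hT.mapsTo hx).1 t, ht⟩

end IsTubularInverse

variable [IsContMDiffRiemannianBundle (𝓡 n) ∞ (Model n) (fun x : M => TangentSpace (𝓡 n) x)]

theorem continuous_norm_snd : Continuous (fun v : TangentBundle (𝓡 n) M => ‖v.2‖) := by
  have := isContinuousRiemannianBundle_tangentSpace (n := n) (M := M)
  have h1 : Continuous (fun v : TangentBundle (𝓡 n) M => (inner ℝ v.2 v.2 : ℝ)) :=
    Continuous.inner_bundle (F := Model n) continuous_id continuous_id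
  have h2 : (fun v : TangentBundle (𝓡 n) M => ‖v.2‖) = fun v => Real.sqrt (inner ℝ v.2 v.2) := by
    ext v
    rw [real_inner_self_eq_norm_sq, Real.sqrt_sq (norm_nonneg _)]
  rw [h2]
  exact h1.sqrt

namespace IsTubularInverse

variable {S : Set M} {r : ℝ} {J : M → TangentBundle (𝓡 n) M} (hT : IsTubularInverse S r J)
include hT

variable [IsRiemannianManifold (𝓡 n) M]

theorem apply_of_mem {q : M} (hq : q ∈ S) : J q = ⟨q, 0⟩ := by
  have h0 : (⟨q, 0⟩ : TangentBundle (𝓡 n) M) ∈ normalDisc S r :=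
    ⟨⟨hq, Submodule.zero_mem _⟩, by simpa using hT.pos⟩
  have h1 := hT.invOn.1 h0
  rwa [expMap_zero] at h1

theorem mem_iff {x : M} (hx : x ∈ Metric.thickening r S) : x ∈ S ↔ (J x).2 = 0 := by
  constructor
  · intro h
    rw [hT.apply_of_mem h]
  · intro h
    have h1 : J x = ⟨(J x).proj, 0⟩ := Bundle.TotalSpace.ext rfl (heq_of_eq h)
    have h2 := hT.invOn.2 hx
    rw [h1, expMap_zero] at h2
    rw [← h2]
    exact hT.mapsTo_proj hx

/-- Inside the tube, `S` is the zero set of the continuous function `‖(J x).2‖`. Openness turns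
smoothness within the complement of `S` into smoothness at its points. -/
theorem isOpen_thickening_diff : IsOpen (Metric.thickening r S \ S) := by
  have h1 : Metric.thickening r S \ S =
      Metric.thickening r S ∩ (fun x => ‖(J x).2‖) ⁻¹' {0}ᶜ := by
    ext x
    constructor
    · exact fun hx => ⟨hx.1, fun h => hx.2 ((hT.mem_iff hx.1).2 (norm_eq_zero.1 h))⟩
    · exact fun hx => ⟨hx.1, fun h => hx.2 (norm_eq_zero.2 ((hT.mem_iff hx.1).1 h))⟩
  rw [h1]
  exact (continuous_norm_snd.comp_continuousOn hT.contMDiffOn.continuousOn).isOpen_inter_preimage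
    Metric.isOpen_thickening isOpen_compl_singleton

/-- Near the zero dilation factor, `(y, t) ↦ h (exp (t J y))` is smooth off `S`, because it is the
composition of the pull-back of `h` to the blow-up with the smooth map
`(y, t) ↦ (exp (t J y), [J y])`. -/
theorem contMDiffAt_dilation {h : M → ℝ}
    (hh : IsSmoothOnBlowUp (fun z : blowUp n S r => h (blowUpMap z))) {y₀ : M}
    (hy₀ : y₀ ∈ Metric.thickening r S \ S) :
    ContMDiffAt ((𝓡 n).prod 𝓘(ℝ, ℝ)) 𝓘(ℝ, ℝ) ∞
      (fun z : M × ℝ => h (expMap (scale z.2 (J z.1)))) (y₀, 0) := by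
  obtain ⟨f', hf', hf'h⟩ := hh
  set O : Set (M × ℝ) := {z | z.1 ∈ Metric.thickening r S \ S ∧ ‖(scale z.2 (J z.1)).2‖ < r} with hO
  have hJ : ∀ z ∈ O, ContMDiffAt ((𝓡 n).prod 𝓘(ℝ, ℝ)) (𝓡 n).tangent ∞
      (fun z : M × ℝ => J z.1) z := fun z hz =>
    ContMDiffAt.comp z (hT.contMDiffOn.contMDiffAt (Metric.isOpen_thickening.mem_nhds hz.1.1))
      contMDiffAt_fst
  have hsc : ∀ z ∈ O, ContMDiffAt ((𝓡 n).prod 𝓘(ℝ, ℝ)) (𝓡 n).tangent ∞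
      (fun z : M × ℝ => scale z.2 (J z.1)) z := fun z hz =>
    ContMDiffAt.comp z (contMDiff_scale (n := n) (M := M)).contMDiffAt
      (contMDiffAt_snd.prodMk (hJ z hz))
  have hE : ContMDiffOn ((𝓡 n).prod 𝓘(ℝ, ℝ)) (𝓡 n) ∞
      (fun z : M × ℝ => expMap (scale z.2 (J z.1))) O :=
    hT.contMDiffOn_exp.comp (fun z hz => (hsc z hz).contMDiffWithinAt)
      (fun z hz => hT.scale_mem_normalDisc hz.1.1 hz.2)
  -- The line is represented by `J z.1` rather than by its multiple `scale z.2 (J z.1)`, so it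
  -- remains defined and smooth across `z.2 = 0`.
  have hpunct : ∀ z ∈ O, J z.1 ∈ puncturedNormalBundle S := fun z hz =>
    ⟨(hT.mapsTo hz.1.1).1, fun h0 => hz.1.2 ((hT.mem_iff hz.1.1).2 h0)⟩
  have hcone : ∀ z (hz : z ∈ O),
      (expMap (scale z.2 (J z.1)), projClass ⟨J z.1, hpunct z hz⟩) ∈ blowUp n S r := fun z hz => by
    exact ⟨hT.mapsTo_exp (hT.scale_mem_normalDisc hz.1.1 hz.2),
      z.2 • (⟨(J z.1).2, (hpunct z hz).1.2⟩ : normalSpace S (J z.1).proj),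
      smul_mem_submodule_mk _ _ _, hz.2, rfl⟩
  have hcomp : ContMDiffOn ((𝓡 n).prod 𝓘(ℝ, ℝ)) 𝓘(ℝ, ℝ) ∞
      (fun z : M × ℝ => h (expMap (scale z.2 (J z.1)))) O := by
    have h1 := hf'.comp (hE.prodMk (fun z hz => (hJ z hz).contMDiffWithinAt))
      (fun z hz => ⟨hpunct z hz, hcone z hz⟩)
    exact h1.congr fun z hz => (hf'h (_, J z.1) (hpunct z hz) (hcone z hz)).symm
  refine hcomp.contMDiffAt ?_
  have h0 : (y₀, (0 : ℝ)) ∈ O := ⟨hy₀, by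
    rw [scale_zero]
    simpa using hT.pos⟩
  have h1 : ∀ᶠ z in 𝓝 (y₀, (0 : ℝ)), z.1 ∈ Metric.thickening r S \ S :=
    (continuous_fst.tendsto _).eventually (hT.isOpen_thickening_diff.mem_nhds hy₀)
  have h2 : ContinuousAt (fun z : M × ℝ => ‖(scale z.2 (J z.1)).2‖) (y₀, 0) :=
    ContinuousAt.comp (g := fun v : TangentBundle (𝓡 n) M => ‖v.2‖)
      continuous_norm_snd.continuousAt (hsc _ h0).continuousAt
  filter_upwards [h1, h2.eventually_lt_const h0.2] with z hz1 hz2 using ⟨hz1, hz2⟩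

end IsTubularInverse

end Tubular

/-! ### The dilation estimate near S. -/

section Estimate

variable {n : ℕ} {M : Type u} [MetricSpace M] [ChartedSpace (Model n) M]
  [IsManifold (𝓡 n) ∞ M] [RiemannianBundle (fun x : M => TangentSpace (𝓡 n) x)]

namespace IsTubularInverse

variable {S : Set M} {r : ℝ} {J : M → TangentBundle (𝓡 n) M}

/-- The derivative of `J`, in coordinates, has a left inverse. -/
theorem exists_leftInverse (hT : IsTubularInverse S r J) {q₀ y₀ : M}
    (hy₀ : y₀ ∈ Metric.thickening r S) (hq₀ : (J y₀).proj ∈ (chartAt (Model n) q₀).source) :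
    ∃ (L' : Model n →L[ℝ] Model n × Model n) (R : Model n × Model n →L[ℝ] Model n),
      HasStrictFDerivAt (fun y => tangentChart q₀ (J ((extChartAt (𝓡 n) y₀).symm y))) L'
        (extChartAt (𝓡 n) y₀ y₀) ∧ R.comp L' = ContinuousLinearMap.id ℝ (Model n) := by
  set ψ := extChartAt (𝓡 n) y₀ with hψ
  set Θ := tangentChart (n := n) q₀ with hΘ
  set m₀ := J y₀ with hm₀
  have hψy : ψ.symm (ψ y₀) = y₀ := extChartAt_to_inv y₀
  have hψs : ContMDiffAt 𝓘(ℝ, Model n) (𝓡 n) ∞ ψ.symm (ψ y₀) :=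
    (contMDiffOn_extChartAt_symm y₀).contMDiffAt (extChartAt_target_mem_nhds _)
  have hB : Metric.thickening r S ∈ 𝓝 y₀ := Metric.isOpen_thickening.mem_nhds hy₀
  have hJψ : ContMDiffAt 𝓘(ℝ, Model n) (𝓡 n).tangent ∞ (fun y => J (ψ.symm y)) (ψ y₀) :=
    ContMDiffAt.comp (ψ y₀) (by rw [hψy]; exact hT.contMDiffOn.contMDiffAt hB) hψs
  have hL : ContDiffAt ℝ ∞ (fun y => Θ (J (ψ.symm y))) (ψ y₀) := by
    rw [← contMDiffAt_iff_contDiffAt]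
    refine ContMDiffAt.comp (ψ y₀) ?_ hJψ
    rw [hψy]
    exact contMDiffAt_tangentChart hq₀
  have hΘm : Θ.symm (Θ m₀) = m₀ := Θ.left_inv (mem_tangentChart_source.2 hq₀)
  have hEd : MDifferentiableWithinAt (𝓡 n).tangent (𝓡 n) expMap (normalDisc S r) m₀ :=
    (hT.contMDiffOn_exp m₀ (hT.mapsTo hy₀)).mdifferentiableWithinAt (by simp)
  have hEm : expMap m₀ = y₀ := hT.invOn.2 hy₀
  have hρ : DifferentiableWithinAt ℝ (fun z => ψ (expMap (Θ.symm z))) (Θ.symm ⁻¹' normalDisc S r)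
      (Θ m₀) := by
    rw [← mdifferentiableWithinAt_iff_differentiableWithinAt]
    have h1 : MDifferentiableWithinAt 𝓘(ℝ, Model n × Model n) (𝓡 n) (fun z => expMap (Θ.symm z))
        (Θ.symm ⁻¹' normalDisc S r) (Θ m₀) :=
      MDifferentiableWithinAt.comp (Θ m₀) (by rwa [hΘm])
        ((contMDiffAt_tangentChart_symm hq₀).mdifferentiableAt (by simp)).mdifferentiableWithinAt
        (fun z hz => hz)
    refine MDifferentiableAt.comp_mdifferentiableWithinAt (Θ m₀) ?_ h1
    rw [hΘm, hEm]
    exact (contMDiffAt_extChartAt (n := ∞)).mdifferentiableAt (by simp)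
  have hstrict := hL.hasStrictFDerivAt (by simp)
  -- The left inverse is a derivative of the exponential map within the normal discs. It need not be
  -- unique there: `J` takes values in the discs, so any such derivative composes with that of `J`
  -- to the derivative of the identity.
  refine ⟨_, fderivWithin ℝ (fun z => ψ (expMap (Θ.symm z))) (Θ.symm ⁻¹' normalDisc S r) (Θ m₀),
    hstrict, ?_⟩
  have hev : ∀ᶠ y in 𝓝 (ψ y₀), y ∈ ψ.target ∧ ψ.symm y ∈ Metric.thickening r S ∧
      Θ.symm (Θ (J (ψ.symm y))) = J (ψ.symm y) := by
    have h2 : ∀ᶠ y in 𝓝 (ψ y₀), J (ψ.symm y) ∈ Θ.source := by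
      refine hJψ.continuousAt.eventually ?_
      change ∀ᶠ y in 𝓝 (J (ψ.symm (ψ y₀))), y ∈ Θ.source
      rw [hψy]
      exact (isOpen_extChartAt_source _).mem_nhds (mem_tangentChart_source.2 hq₀)
    have h3 : ∀ᶠ y in 𝓝 (ψ y₀), ψ.symm y ∈ Metric.thickening r S := by
      refine hψs.continuousAt.eventually ?_
      rwa [hψy]
    filter_upwards [extChartAt_target_mem_nhds y₀, h2, h3] with y hy1 hy2 hy3
    exact ⟨hy1, hy3, Θ.left_inv hy2⟩
  have hcomp := HasFDerivWithinAt.comp_hasFDerivAt_of_eq (ψ y₀) hρ.hasFDerivWithinAt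
    hstrict.hasFDerivAt (by
      filter_upwards [hev] with y hy
      rw [mem_preimage, hy.2.2]
      exact hT.mapsTo hy.2.1) (by rw [hψy])
  refine hcomp.unique ((hasFDerivAt_id (ψ y₀)).congr_of_eventuallyEq ?_)
  filter_upwards [hev] with y hy
  simp only [Function.comp_apply, hy.2.2, hT.invOn.2 hy.2.1, id]
  exact ψ.right_inv hy.1

variable [IsContMDiffRiemannianBundle (𝓡 n) ∞ (Model n) (fun x : M => TangentSpace (𝓡 n) x)]
  [IsRiemannianManifold (𝓡 n) M]

/-- In the coordinates `x ↦ φ.symm x` near a point of `S`, the difference between `h` and its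
composition with the projection to `S` is flat to first order along `S`. -/
theorem eventually_small (hT : IsTubularInverse S r J) {h : M → ℝ}
    (hsm : IsSmoothOnBlowUp (fun z : blowUp n S r => h (blowUpMap z)))
    (hS : ContMDiffOn (𝓡 n) 𝓘(ℝ, ℝ) ∞ h S)
    (hnormal : ∀ v ∈ normalBundle (n := n) S,
      HasDerivAt (fun t : ℝ => h (expMap (scale t v))) 0 0)
    {q₀ q : M} (hq : q ∈ S) (hq₀ : q ∈ (chartAt (Model n) q₀).source) :
    ∃ K > 0, ∀ ε > 0, ∀ᶠ x in 𝓝 (extChartAt (𝓡 n) q₀ q),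
      (tangentChart q₀ (J ((extChartAt (𝓡 n) q₀).symm x))).2 ≠ 0 →
      |h ((extChartAt (𝓡 n) q₀).symm x) - h (J ((extChartAt (𝓡 n) q₀).symm x)).proj| ≤
        ε * (K * ‖(tangentChart q₀ (J ((extChartAt (𝓡 n) q₀).symm x))).2‖) ∧
      ‖fderiv ℝ (fun x => h ((extChartAt (𝓡 n) q₀).symm x) -
        h (J ((extChartAt (𝓡 n) q₀).symm x)).proj) x‖ ≤ ε := by
  set φ := extChartAt (𝓡 n) q₀ with hφ
  set Θ := tangentChart (n := n) q₀ with hΘ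
  set e := trivializationAt (Model n) (TangentSpace (𝓡 n) : M → Type _) q₀ with he
  have hqe : q ∈ e.baseSet := hq₀
  have hqB : q ∈ Metric.thickening r S := hT.subset_thickening hq
  have hqφ : q ∈ φ.source := by rwa [hφ, extChartAt_source]
  have hφq : φ.symm (φ q) = q := φ.left_inv hqφ
  have hB : Metric.thickening r S ∈ 𝓝 q := Metric.isOpen_thickening.mem_nhds hqB
  have hJq : J q = ⟨q, 0⟩ := hT.apply_of_mem hq
  have hφt : φ.target ∈ 𝓝 (φ q) := extChartAt_target_mem_nhds' (φ.map_source hqφ)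
  have hφs : ContMDiffAt 𝓘(ℝ, Model n) (𝓡 n) ∞ φ.symm (φ q) :=
    (contMDiffOn_extChartAt_symm q₀).contMDiffAt hφt
  have hJφ : ContMDiffAt 𝓘(ℝ, Model n) (𝓡 n).tangent ∞ (fun x => J (φ.symm x)) (φ q) :=
    ContMDiffAt.comp (φ q) (by rw [hφq]; exact hT.contMDiffOn.contMDiffAt hB) hφs
  set P : Model n → Model n × Model n := fun x => Θ (J (φ.symm x)) with hP
  have hPs : ContDiffAt ℝ ∞ P (φ q) := by
    rw [← contMDiffAt_iff_contDiffAt]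
    refine ContMDiffAt.comp (φ q) ?_ hJφ
    rw [hφq, hJq]
    exact contMDiffAt_tangentChart hq₀
  have hPq : P (φ q) = (φ q, 0) := by
    simp only [hP]
    rw [hφq, hJq]
    exact tangentChart_mk_zero hq₀
  have hgood : ∀ᶠ x in 𝓝 (φ q), x ∈ φ.target ∧ φ.symm x ∈ Metric.thickening r S ∧
      (J (φ.symm x)).proj ∈ (chartAt (Model n) q₀).source := by
    have h2 : ∀ᶠ x in 𝓝 (φ q), J (φ.symm x) ∈ Θ.source := by
      refine hJφ.continuousAt.eventually ?_
      change ∀ᶠ y in 𝓝 (J (φ.symm (φ q))), y ∈ Θ.source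
      rw [hφq, hJq]
      exact (isOpen_extChartAt_source _).mem_nhds (mem_tangentChart_source.2 hq₀)
    have h3 : ∀ᶠ y in 𝓝 (φ q), φ.symm y ∈ Metric.thickening r S := by
      refine hφs.continuousAt.eventually ?_
      rwa [hφq]
    filter_upwards [hφt, h2, h3] with y hy1 hy2 hy3
    exact ⟨hy1, hy3, mem_tangentChart_source.1 hy2⟩
  set A : Model n →L[ℝ] TangentSpace (𝓡 n) q := e.symmL ℝ q with hA
  have hr := hT.pos
  -- The limiting direction will have coordinate norm `K⁻¹`, hence Riemannian norm at most r‖A‖ /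
  -- (‖A‖ + 1) < r, which keeps it in the normal disc.
  set K : ℝ := (‖A‖ + 1) / r with hK
  have hK0 : 0 < K := by positivity
  refine ⟨K, hK0, fun ε hε => ?_⟩
  refine eventually_inf_principal (s := {x | (P x).2 ≠ 0}).1 ?_
  -- Along an ultrafilter the normalised normal directions converge on the compact sphere, so the
  -- bound is only needed near one limiting direction at a time.
  refine mem_iff_ultrafilter.2 fun 𝒰 h𝒰 => ?_
  have h𝒰p : (𝒰 : Filter (Model n)) ≤ 𝓝 (φ q) := h𝒰.trans inf_le_left
  have hne : ∀ᶠ x in (𝒰 : Filter (Model n)), (P x).2 ≠ 0 :=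
    (h𝒰.trans inf_le_right) (mem_principal_self _)
  set τ : Model n → ℝ := fun x => K * ‖(P x).2‖ with hτ
  have hτ0 : ∀ᶠ x in (𝒰 : Filter (Model n)), 0 < τ x := by
    filter_upwards [hne] with x hx
    have := norm_pos_iff.2 hx
    positivity
  have hPlim : Tendsto P 𝒰 (𝓝 (φ q, 0)) := by
    rw [← hPq]
    exact hPs.continuousAt.tendsto.mono_left h𝒰p
  have hτlim : Tendsto τ 𝒰 (𝓝 0) := by
    have h1 : Tendsto (fun x => K * ‖(P x).2‖) 𝒰 (𝓝 (K * ‖((φ q, 0) : Model n × Model n).2‖)) :=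
      (((continuous_snd.tendsto _).comp hPlim).norm).const_mul K
    simpa using h1
  -- the limit of the directions
  have hsphere : ∀ᶠ x in (𝒰 : Filter (Model n)), (τ x)⁻¹ • (P x).2 ∈ Metric.sphere (0 : Model n) K⁻¹ := by
    filter_upwards [hne] with x hx
    have h1 := norm_pos_iff.2 hx
    rw [mem_sphere_zero_iff_norm, norm_smul, norm_inv, Real.norm_of_nonneg (by positivity), hτ]
    field_simp
  obtain ⟨u₀, hu₀, hu₀lim⟩ := (isCompact_sphere (0 : Model n) K⁻¹).ultrafilter_le_nhds'
    (𝒰.map fun x => (τ x)⁻¹ • (P x).2) hsphere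
  have hulim : Tendsto (fun x => (τ x)⁻¹ • (P x).2) 𝒰 (𝓝 u₀) := hu₀lim
  rw [mem_sphere_zero_iff_norm] at hu₀
  set m₀ : TangentBundle (𝓡 n) M := ⟨q, A u₀⟩ with hm₀
  have hΘm₀ : Θ m₀ = (φ q, u₀) := by
    rw [hΘ, tangentChart_apply]
    have h1 : e m₀ = (q, u₀) := by
      rw [hm₀, hA, Trivialization.symmL_apply _ hqe]
      exact e.apply_mk_symm hqe u₀
    have h2 : (e m₀).2 = u₀ := by rw [h1]
    exact Prod.ext rfl h2
  have hm₀src : m₀ ∈ Θ.source := mem_tangentChart_source.2 hq₀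
  set m : Model n → TangentBundle (𝓡 n) M := fun x => scale (τ x)⁻¹ (J (φ.symm x)) with hm
  have hmlim : Tendsto m 𝒰 (𝓝 m₀) := by
    have h1 : Tendsto (fun x => Θ.symm ((P x).1, (τ x)⁻¹ • (P x).2)) 𝒰 (𝓝 (Θ.symm (Θ m₀))) := by
      rw [hΘm₀]
      refine Tendsto.comp ?_ (((continuous_fst.tendsto _).comp hPlim).prodMk_nhds hulim)
      rw [← hΘm₀]
      exact (contMDiffAt_tangentChart_symm hq₀).continuousAt
    rw [Θ.left_inv hm₀src] at h1
    refine h1.congr' ?_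
    filter_upwards [h𝒰p hgood] with x hx
    rw [← tangentChart_scale _ hx.2.2]
    exact Θ.left_inv (mem_tangentChart_source.2 hx.2.2)
  have hmnormal : ∀ᶠ x in (𝒰 : Filter (Model n)), m x ∈ normalBundle S := by
    filter_upwards [h𝒰p hgood] with x hx
    exact scale_mem_normalBundle (hT.mapsTo hx.2.1).1 _
  -- The limit of the dilated normal vectors must again be normal for its exponential `y₀` to be a
  -- point of the tube with `J y₀ = m₀`.
  have hm₀normal : m₀ ∈ normalBundle S :=
    mem_normalBundle_of_mem_closure Metric.isOpen_thickening hT.subset_thickening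
      hT.contMDiffOn_proj hT.mapsTo_proj (fun x hx => by rw [hT.apply_of_mem hx])
      (mem_closure_of_tendsto hmlim hmnormal) hq
  have hm₀norm : ‖m₀.2‖ < r := by
    have h1 : ‖m₀.2‖ ≤ ‖A‖ * K⁻¹ := by
      rw [← hu₀]
      exact A.le_opNorm u₀
    refine h1.trans_lt ?_
    rw [hK, inv_div, mul_div_assoc', div_lt_iff₀ (by positivity)]
    nlinarith
  have hm₀D : m₀ ∈ normalDisc S r := ⟨hm₀normal, hm₀norm⟩
  have hmD : ∀ᶠ x in (𝒰 : Filter (Model n)), m x ∈ normalDisc S r := by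
    filter_upwards [hmnormal, (continuous_norm_snd.continuousAt.tendsto.comp
      hmlim).eventually_lt_const hm₀norm] with x hx1 hx2 using ⟨hx1, hx2⟩
  set y₀ : M := expMap m₀ with hy₀
  have hy₀B : y₀ ∈ Metric.thickening r S := hT.mapsTo_exp hm₀D
  have hJy₀ : J y₀ = m₀ := hT.invOn.1 hm₀D
  have hm₀ne : m₀.2 ≠ 0 := by
    rw [Ne, ← tangentChart_snd_eq_zero_iff (q₀ := q₀) hq₀, ← hΘ, hΘm₀]
    exact norm_pos_iff.1 (by rw [hu₀]; positivity)
  have hy₀S : y₀ ∈ Metric.thickening r S \ S :=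
    ⟨hy₀B, fun hmem => hm₀ne (by rw [← hJy₀]; exact (hT.mem_iff hy₀B).1 hmem)⟩
  set ψ := extChartAt (𝓡 n) y₀ with hψ
  have hylim : Tendsto (fun x => expMap (m x)) 𝒰 (𝓝 y₀) :=
    (hT.contMDiffOn_exp.continuousOn m₀ hm₀D).tendsto.comp
      (tendsto_nhdsWithin_iff.2 ⟨hmlim, hmD⟩)
  have hψy : ψ.symm (ψ y₀) = y₀ := extChartAt_to_inv y₀
  have hψs : ContMDiffAt 𝓘(ℝ, Model n) (𝓡 n) ∞ ψ.symm (ψ y₀) :=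
    (contMDiffOn_extChartAt_symm y₀).contMDiffAt (extChartAt_target_mem_nhds _)
  have hψB : ∀ᶠ y in 𝓝 (ψ y₀), ψ.symm y ∈ Metric.thickening r S := by
    refine hψs.continuousAt.eventually ?_
    rw [hψy]
    exact Metric.isOpen_thickening.mem_nhds hy₀B
  set G : Model n × ℝ → ℝ := fun z =>
    h (expMap (scale z.2 (J (ψ.symm z.1)))) - h (J (ψ.symm z.1)).proj with hG
  have hproj : ContMDiffAt (𝓡 n) 𝓘(ℝ, ℝ) ∞ (fun y => h (J y).proj) y₀ :=
    (hS.comp hT.contMDiffOn_proj hT.mapsTo_proj).contMDiffAt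
      (Metric.isOpen_thickening.mem_nhds hy₀B)
  have hGs : ContDiffAt ℝ 2 G (ψ y₀, 0) := by
    refine ContDiffAt.of_le (n := ∞) ?_ (by norm_cast)
    rw [← contMDiffAt_iff_contDiffAt]
    have h1 : ContMDiffAt 𝓘(ℝ, Model n × ℝ) (𝓡 n) ∞ (fun z : Model n × ℝ => ψ.symm z.1)
        (ψ y₀, (0 : ℝ)) :=
      ContMDiffAt.comp (ψ y₀, (0 : ℝ)) hψs contDiff_fst.contMDiff.contMDiffAt
    have h2 : ContMDiffAt 𝓘(ℝ, Model n × ℝ) 𝓘(ℝ, ℝ) ∞ (fun z : Model n × ℝ => z.2)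
        (ψ y₀, (0 : ℝ)) := contDiff_snd.contMDiff.contMDiffAt
    have h3 : ContMDiffAt 𝓘(ℝ, Model n × ℝ) 𝓘(ℝ, ℝ) ∞
        (fun z : Model n × ℝ => h (expMap (scale z.2 (J (ψ.symm z.1))))) (ψ y₀, (0 : ℝ)) :=
      ContMDiffAt.comp (ψ y₀, (0 : ℝ)) (g := fun z : M × ℝ => h (expMap (scale z.2 (J z.1))))
        (by rw [hψy]; exact hT.contMDiffAt_dilation hsm hy₀S) (h1.prodMk h2)
    have h4 : ContMDiffAt 𝓘(ℝ, Model n × ℝ) 𝓘(ℝ, ℝ) ∞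
        (fun z : Model n × ℝ => h (J (ψ.symm z.1)).proj) (ψ y₀, (0 : ℝ)) :=
      ContMDiffAt.comp (ψ y₀, (0 : ℝ)) (g := fun y => h (J y).proj) (by rwa [hψy]) h1
    exact h3.sub h4
  have hG0 : ∀ᶠ y in 𝓝 (ψ y₀), G (y, 0) = 0 := .of_forall fun y => by
    simp only [hG]
    rw [scale_zero, expMap_zero, sub_self]
  -- This is the vanishing normal derivative of `h`, in the direction `J (ψ.symm y)`.
  have hG1 : ∀ᶠ y in 𝓝 (ψ y₀), HasDerivAt (fun t : ℝ => G (y, t)) 0 0 := by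
    filter_upwards [hψB] with y hy
    simp only [hG]
    exact (hnormal _ (hT.mapsTo hy).1).sub_const (h (J (ψ.symm y)).proj)
  obtain ⟨L', R, hL, hR⟩ := hT.exists_leftInverse (q₀ := q₀) hy₀B (by rw [hJy₀]; exact hq₀)
  refine eventually_small_of_flat (η := fun x t => ψ (expMap (scale t⁻¹ (J (φ.symm x)))))
    (P := P) (p := φ q) hGs hG0 hG1 hL hR (hPs.of_le (by norm_cast)) h𝒰p hτlim hτ0 ?_ ?_ hε
  · exact (continuousAt_extChartAt y₀).tendsto.comp hylim
  filter_upwards [h𝒰p hgood.eventually_nhds, hmD, hτ0,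
    hylim.eventually (extChartAt_source_mem_nhds (I := 𝓡 n) y₀)] with x hx1 hx2 hx3 hx4
  obtain ⟨hxt, hxB, hxs⟩ := hx1.self_of_nhds
  have hJx : ContinuousAt (fun x' => J (φ.symm x')) x :=
    ContinuousAt.comp (hT.contMDiffOn.continuousOn.continuousAt
      (Metric.isOpen_thickening.mem_nhds hxB)) (continuousAt_extChartAt_symm'' hxt)
  have hmx : ContinuousAt (fun x' => scale (τ x)⁻¹ (J (φ.symm x'))) x :=
    ContinuousAt.comp (g := fun z : ℝ × TangentBundle (𝓡 n) M => scale z.1 z.2)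
      contMDiff_scale.continuous.continuousAt (continuousAt_const.prodMk hJx)
  have hD : ∀ᶠ x' in 𝓝 x, scale (τ x)⁻¹ (J (φ.symm x')) ∈ normalDisc S r := by
    have h1 := (ContinuousAt.comp (g := fun v : TangentBundle (𝓡 n) M => ‖v.2‖)
      continuous_norm_snd.continuousAt hmx).eventually_lt_const hx2.2
    filter_upwards [h1, hx1] with x' k1 k2
    exact hT.scale_mem_normalDisc k2.2.1 k1
  have hyx : ContinuousAt (fun x' => expMap (scale (τ x)⁻¹ (J (φ.symm x')))) x :=
    (hT.contMDiffOn_exp.continuousOn _ hx2).tendsto.comp (tendsto_nhdsWithin_iff.2 ⟨hmx, hD⟩)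
  refine ⟨ContinuousAt.comp (continuousAt_extChartAt' hx4) hyx, ?_⟩
  filter_upwards [hx1, hD, hyx.eventually ((isOpen_extChartAt_source y₀).mem_nhds hx4)]
    with x' k1 k2 k3
  have e1 : ψ.symm (ψ (expMap (scale (τ x)⁻¹ (J (φ.symm x'))))) =
    expMap (scale (τ x)⁻¹ (J (φ.symm x'))) := ψ.left_inv k3
  have e2 : J (expMap (scale (τ x)⁻¹ (J (φ.symm x')))) = scale (τ x)⁻¹ (J (φ.symm x')) :=
    hT.invOn.1 k2
  -- Dilating by `(τ x)⁻¹` and then by `τ x` returns the point, and dilation does not move the foot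
  -- on `S`; so the function is `G` at the dilated point. In the coordinates `Θ ∘ J`, dilation
  -- multiplies the fibre component by `(τ x)⁻¹`.
  constructor
  · simp only [hG]
    rw [e1, e2, scale_scale, mul_inv_cancel₀ hx3.ne', scale_one, hT.invOn.2 k1.2.1, scale_proj]
  · change Θ (J (ψ.symm (ψ _))) = _
    rw [e1, e2]
    exact tangentChart_scale _ k1.2.2

end IsTubularInverse

end Estimate

/-! ### From flatness along S to class C¹. -/

section Regularity

variable {n : ℕ} {M : Type u} [MetricSpace M] [ChartedSpace (Model n) M]
  [IsManifold (𝓡 n) ∞ M] [RiemannianBundle (fun x : M => TangentSpace (𝓡 n) x)]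
  [IsContMDiffRiemannianBundle (𝓡 n) ∞ (Model n) (fun x : M => TangentSpace (𝓡 n) x)]
  [IsRiemannianManifold (𝓡 n) M]

/-- A function on a normed space which is `C¹` off the zero set of `v`, vanishes on it, and is
flat to first order along it is `C¹`. -/
theorem contDiffAt_one_of_flat {V W : Type*} [NormedAddCommGroup V] [NormedSpace ℝ V]
    [NormedAddCommGroup W] [NormedSpace ℝ W] {g : V → ℝ} {v : V → W} {p : V}
    (hv : ∀ᶠ x in 𝓝 p, DifferentiableAt ℝ v x)
    (hoff : ∀ᶠ x in 𝓝 p, v x ≠ 0 → ContDiffAt ℝ 1 g x)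
    (hon : ∀ᶠ x in 𝓝 p, v x = 0 → g x = 0)
    (hflat : ∀ᶠ x in 𝓝 p, v x = 0 → ∃ K > 0, ∀ ε > 0, ∀ᶠ x' in 𝓝 x, v x' ≠ 0 →
      |g x'| ≤ ε * (K * ‖v x'‖) ∧ ‖fderiv ℝ g x'‖ ≤ ε) :
    ContDiffAt ℝ 1 g p := by
  -- At a zero `x` of `v`, g = o(v), while v = O(x' - x) by differentiability; hence `g` has
  -- derivative zero. This is needed at all zeros near `p`, so that the derivative exists on a
  -- neighbourhood.
  have hzero : ∀ᶠ x in 𝓝 p, v x = 0 → HasFDerivAt g (0 : V →L[ℝ] ℝ) x := by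
    filter_upwards [hv, hon.eventually_nhds, hflat] with x h1 h2 h3 hx
    obtain ⟨K, hK, h4⟩ := h3 hx
    have h5 : g =o[𝓝 x] v := by
      refine Asymptotics.isLittleO_iff.2 fun c hc => ?_
      filter_upwards [h4 (c / K) (by positivity), h2] with x' k1 k2
      by_cases hx' : v x' = 0
      · simp [k2 hx', hx']
      · refine (k1 hx').1.trans_eq ?_
        field_simp
    have h6 : v =O[𝓝 x] fun x' => x' - x := by
      simpa [hx] using h1.hasFDerivAt.isBigO_sub
    refine HasFDerivAt.of_isLittleO ?_
    simpa [h2.self_of_nhds hx] using h5.trans_isBigO h6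
  have hall : ∀ᶠ x in 𝓝 p, HasFDerivAt g (fderiv ℝ g x) x := by
    filter_upwards [hzero, hoff] with x h1 h2
    by_cases hx : v x = 0
    · rw [(h1 hx).fderiv]
      exact h1 hx
    · exact ((h2 hx).differentiableAt one_ne_zero).hasFDerivAt
  have hcont : ∀ᶠ x in 𝓝 p, ContinuousAt (fderiv ℝ g) x := by
    filter_upwards [hzero.eventually_nhds, hoff, hflat] with x h1 h2 h3
    by_cases hx : v x = 0
    · rw [ContinuousAt, (h1.self_of_nhds hx).fderiv]
      obtain ⟨K, hK, h4⟩ := h3 hx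
      refine Metric.tendsto_nhds.2 fun ε hε => ?_
      filter_upwards [h4 (ε / 2) (by positivity), h1] with x' k1 k2
      rw [dist_zero_right]
      by_cases hx' : v x' = 0
      · rw [(k2 hx').fderiv, norm_zero]
        exact hε
      · linarith [(k1 hx').2]
    · exact (h2 hx).continuousAt_fderiv one_ne_zero
  rw [contDiffAt_one_iff]
  exact ⟨fderiv ℝ g, {x | HasFDerivAt g (fderiv ℝ g x) x ∧ ContinuousAt (fderiv ℝ g) x},
    hall.and hcont, fun x hx => hx.2.continuousWithinAt, fun x hx => hx.1⟩

/-- Subtracting the smooth function `h ∘ π`, with π the foot map, leaves a function vanishing on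
`S`. In a chart, `S` is the zero set of the fibre coordinate of `J`, along which `eventually_small`
supplies the flatness. -/
theorem IsTubularInverse.contMDiffAt_of_mem {S : Set M} {r : ℝ} {J : M → TangentBundle (𝓡 n) M}
    (hT : IsTubularInverse S r J) {h : M → ℝ}
    (hsm : IsSmoothOnBlowUp (fun z : blowUp n S r => h (blowUpMap z)))
    (hS : ContMDiffOn (𝓡 n) 𝓘(ℝ, ℝ) ∞ h S)
    (hoff : ContMDiffOn (𝓡 n) 𝓘(ℝ, ℝ) ∞ h (Metric.thickening r S \ S))
    (hnormal : ∀ v ∈ normalBundle (n := n) S,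
      HasDerivAt (fun t : ℝ => h (expMap (scale t v))) 0 0)
    {q₀ : M} (hq₀ : q₀ ∈ S) : ContMDiffAt (𝓡 n) 𝓘(ℝ, ℝ) 1 h q₀ := by
  set φ := extChartAt (𝓡 n) q₀ with hφ
  have hqB : q₀ ∈ Metric.thickening r S := hT.subset_thickening hq₀
  have hφq : φ.symm (φ q₀) = q₀ := extChartAt_to_inv q₀
  have hproj : ContMDiffOn (𝓡 n) 𝓘(ℝ, ℝ) ∞ (fun y => h (J y).proj) (Metric.thickening r S) :=
    hS.comp hT.contMDiffOn_proj hT.mapsTo_proj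
  have hφs : ∀ x ∈ φ.target, ContMDiffAt 𝓘(ℝ, Model n) (𝓡 n) ∞ φ.symm x := fun x hx =>
    (contMDiffOn_extChartAt_symm q₀).contMDiffAt ((isOpen_extChartAt_target q₀).mem_nhds hx)
  have hφt : ∀ᶠ x in 𝓝 (φ q₀), x ∈ φ.target := extChartAt_target_mem_nhds q₀
  have hB : ∀ᶠ x in 𝓝 (φ q₀), φ.symm x ∈ Metric.thickening r S := by
    refine (hφs _ (φ.map_source (mem_extChartAt_source q₀))).continuousAt.eventually ?_
    rw [hφq]
    exact Metric.isOpen_thickening.mem_nhds hqB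
  have hJc : ContinuousAt (fun x => J (φ.symm x)) (φ q₀) := by
    refine ContinuousAt.comp ?_ (hφs _ (φ.map_source (mem_extChartAt_source q₀))).continuousAt
    rw [hφq]
    exact hT.contMDiffOn.continuousOn.continuousAt (Metric.isOpen_thickening.mem_nhds hqB)
  have hsrc : ∀ᶠ x in 𝓝 (φ q₀), J (φ.symm x) ∈ (tangentChart (n := n) q₀).source := by
    refine hJc.eventually ?_
    change ∀ᶠ v in 𝓝 (J (φ.symm (φ q₀))), v ∈ (tangentChart (n := n) q₀).source
    rw [hφq, hT.apply_of_mem hq₀]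
    exact (isOpen_extChartAt_source _).mem_nhds (mem_tangentChart_source.2 (mem_chart_source _ _))
  have hmem : ∀ᶠ x in 𝓝 (φ q₀),
      ((tangentChart q₀ (J (φ.symm x))).2 = 0 ↔ φ.symm x ∈ S) := by
    filter_upwards [hB, hsrc] with x hx1 hx2
    rw [tangentChart_snd_eq_zero_iff (mem_tangentChart_source.1 hx2), hT.mem_iff hx1]
  have key : ContDiffAt ℝ 1 (fun x => h (φ.symm x) - h (J (φ.symm x)).proj) (φ q₀) := by
    refine contDiffAt_one_of_flat (v := fun x => (tangentChart q₀ (J (φ.symm x))).2) ?_ ?_ ?_ ?_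
    · filter_upwards [hφt, hB, hsrc] with x hx1 hx2 hx3
      have h1 : ContMDiffAt 𝓘(ℝ, Model n) 𝓘(ℝ, Model n × Model n) ∞
          (fun x => tangentChart q₀ (J (φ.symm x))) x :=
        ContMDiffAt.comp x (contMDiffAt_tangentChart (mem_tangentChart_source.1 hx3))
          (ContMDiffAt.comp x (hT.contMDiffOn.contMDiffAt (Metric.isOpen_thickening.mem_nhds hx2))
            (hφs x hx1))
      exact (h1.contDiffAt.differentiableAt (by simp)).snd
    · filter_upwards [hφt, hB, hmem] with x hx1 hx2 hx3 hx4
      rw [Ne, hx3] at hx4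
      rw [← contMDiffAt_iff_contDiffAt]
      have h1 : ContMDiffAt 𝓘(ℝ, Model n) 𝓘(ℝ, ℝ) ∞ (fun x => h (φ.symm x)) x :=
        ContMDiffAt.comp x (hoff.contMDiffAt (hT.isOpen_thickening_diff.mem_nhds ⟨hx2, hx4⟩))
          (hφs x hx1)
      have h2 : ContMDiffAt 𝓘(ℝ, Model n) 𝓘(ℝ, ℝ) ∞ (fun x => h (J (φ.symm x)).proj) x :=
        ContMDiffAt.comp x (g := fun y => h (J y).proj)
          (hproj.contMDiffAt (Metric.isOpen_thickening.mem_nhds hx2)) (hφs x hx1)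
      exact (h1.sub h2).of_le (by norm_cast)
    · filter_upwards [hmem] with x hx1 hx2
      rw [hT.apply_of_mem (hx1.1 hx2), sub_self]
    · filter_upwards [hφt, hmem] with x hx1 hx2 hx3
      have hxs : φ.symm x ∈ (chartAt (Model n) q₀).source := by
        rw [← extChartAt_source (𝓡 n)]
        exact φ.map_target hx1
      have h1 := hT.eventually_small hsm hS hnormal (hx2.1 hx3) hxs
      rwa [← hφ, φ.right_inv hx1] at h1
  have key' : ContMDiffAt (𝓡 n) 𝓘(ℝ, ℝ) 1
      (fun y => h (φ.symm (φ y)) - h (J (φ.symm (φ y))).proj) q₀ :=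
    ContMDiffAt.comp q₀ (g := fun x => h (φ.symm x) - h (J (φ.symm x)).proj) key.contMDiffAt
      contMDiffAt_extChartAt
  refine (key'.add ((hproj.contMDiffAt
    (Metric.isOpen_thickening.mem_nhds hqB)).of_le (by norm_cast))).congr_of_eventuallyEq ?_
  filter_upwards [extChartAt_source_mem_nhds (I := 𝓡 n) q₀] with y hy
  simp only [Pi.add_apply]
  rw [φ.left_inv hy, sub_add_cancel]

end Regularity

end BlowUpFoliation

end

theorem mainTheorem4 {n : ℕ} {M : Type u} [MetricSpace M] [CompleteSpace M]
    [ChartedSpace (BlowUpFoliation.Model n) M] [IsManifold (𝓡 n) ∞ M]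
    [RiemannianBundle (fun x : M => TangentSpace (𝓡 n) x)]
    [IsContMDiffRiemannianBundle (𝓡 n) ∞ (BlowUpFoliation.Model n)
      (fun x : M => TangentSpace (𝓡 n) x)]
    [IsRiemannianManifold (𝓡 n) M]
    (F : BlowUpFoliation.SingularRiemannianFoliation n M)
    (hF : ∀ p : M, IsClosed (F.leaf p))
    (S : Set M) (hS : F.IsMinimalStratum S)
    (r : ℝ) (hr : BlowUpFoliation.IsTubularRadius n S r)
    (h : M → ℝ) (hh : BlowUpFoliation.IsBlowUpFunction F S r h) :
    ContMDiffOn (𝓡 n) 𝓘(ℝ, ℝ) 1 h (Metric.thickening r S) := by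
  obtain ⟨J, hT⟩ := hr.exists_isTubularInverse
  intro x hx
  by_cases hxS : x ∈ S
  · exact (hT.contMDiffAt_of_mem hh.smooth_pullback hh.smooth_on_stratum hh.smooth_off_stratum
      hh.normal_deriv hxS).contMDiffWithinAt
  · exact ((hh.smooth_off_stratum.contMDiffAt
      (hT.isOpen_thickening_diff.mem_nhds ⟨hx, hxS⟩)).of_le (by norm_cast)).contMDiffWithinAt
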